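/- Let $W_1,W_2\in\mathbb C[x_1,\dots,x_6]$ be homogeneous of degree $3$ and write $W_j=\sum_{i=1}^6 x_if_{ji}$ with $f_{ji}$ homogeneous of degree $2$. Let $\mathbb C^*$ act on $V=\operatorname{Spec}\mathbb C[x_1,\dots,x_6,p_1,p_2]$ with weights $(1^6,(-3)^2)$ and the R-charge torus $\mathbb C^*_R$ with weights $(0^6,2^2)$, and put $W=p_1W_1+p_2W_2$, $X_+=[(\mathbb C^6\setminus 0)\times\mathbb C^2/\mathbb C^*]$, $X_-=[\mathbb C^6\times(\mathbb C^2\setminus 0)/\mathbb C^*]$. Let $\mathcal O(k)[l]$ be the line bundle on $X_\pm$ with $\mathbb C^*$-weight $k$ and R-weight $l$ on the fibre. A graded matrix factorization over $(X_\pm,W)$ is a $\mathbb C_R^*$-equivariant vector bundle $E$ of finite rank with an endomorphism $d$ of R-weight $1$ such that $d^2=W\cdot\mathrm{Id}$; a direct sum of line bundles $\mathcal O(k)[l]$ with a matrix of polynomials $d$ gives one over $X_+$ and one over $X_-$ at once. $\mathrm{DMF}(X_\pm,W)$ is the homotopy category of the dg category of graded matrix factorizations, with complexes of derived global sections of $\mathcal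 Hom(E,F)$ as morphism complexes. Write $E(k)[l]=(E\otimes\mathcal O(k)[l],d\otimes\mathrm{Id})$. The shift functor is $(E,d)\mapsto(E\otimes\mathcal O[1],-d\otimes\mathrm{Id})$, and for a $\mathbb C^*_R$-equivariant morphism $g\colon E_1\to E_2$ commuting with the differentials, $\operatorname{cone}(g)=\left(E_1[1]\oplus E_2,\begin{pmatrix}-d_1&0\\ g&d_2\end{pmatrix}\right)$. Let $$\mathcal K_-=\Big(\textstyle\bigwedge^\bullet\mathcal O(1)[-1]^{\oplus 6},\ (x_i)_i\wedge(-)+(p_1f_{1i}+p_2f_{2i})_i\vee(-)\Big),\qquad \mathcal K_+=\Big(\textstyle\bigwedge^\bullet\mathcal O(-3)[1]^{\oplus 2},\ (p_1,p_2)\wedge(-)+(W_1,W_2)\vee(-)\Big).$$ Then there is a sequence $\mathcal K_-^{(1)},\mathcal K_-^{(2)},\mathcal K_-^{(3)},\dots$ of graded matrix factorizations over $(X_\pm,W)$ such that the following hold for all $t\ge 1$. 1. $\mathcal K_-^{(t)}\cong\mathcal K_-$ in $\mathrm{DMF}(X_-,W)$. 2. The underlying bundle of $\mathcal K_-^{(t)}$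 is a direct sum of line bundles $\mathcal O(k)[l]$ with $t\le k\le t+5$. 3. Write the part of the underlying bundle of $\mathcal K_-^{(t)}$ given by all summands $\mathcal O(t)[l]$ as $\bigoplus_{i=1}^s\mathcal O(t)[n_i]^{\oplus m_i}$ with $n_1>n_2>\dots>n_s$ and $m_i\ge 1$. Then there are graded matrix factorizations $\mathcal K_-^{(t)(0)}=\mathcal K_-^{(t)},\ \mathcal K_-^{(t)(1)},\dots,\ \mathcal K_-^{(t)(s)}=\mathcal K_-^{(t+1)}$ over $(X_\pm,W)$ such that for every $1\le i\le s$ there is a morphism of graded matrix factorizations $g_i\colon\mathcal K_-^{(t)(i-1)}\to\mathcal K_+(t+6)[n_i-2]^{\oplus m_i}$ with $$\mathcal K_-^{(t)(i)}\cong\operatorname{cone}(g_i)[-1]\quad\text{in }\mathrm{DMF}(X_+,W)\text{ and in }\mathrm{DMF}(X_-,W),$$ and the underlying bundle of $\mathcal K_-^{(t)(i)}$ is obtained from that of $\mathcal K_-^{(t)(i-1)}$ by replacing the summand $\mathcal O(t)[n_i]^{\oplus m_i}$ by $\mathcal O(t+6)[n_i-3]^{\oplus m_i}\oplus\mathcal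 O(t+3)[n_i-2]^{\oplus 2m_i}$. -/

import Mathlib

/-
Graded matrix factorizations on the two Landau-Ginzburg models `(X_+, W)` and `(X_-, W)`, where
`V = Spec ℂ[x_1, …, x_6, p_1, p_2]`, the torus `ℂ^*` acts with weights `(1^6, (-3)^2)`, and
`X_+ = [(ℂ^6 ∖ 0) × ℂ^2 / ℂ^*]`, `X_- = [ℂ^6 × (ℂ^2 ∖ 0) / ℂ^*]`; the R-charge torus acts with
weights `(0^6, 2^2)`.

A graded matrix factorization whose underlying bundle is a finite sum of line bundles `O(k)[l]` is
recorded by its matrix. Both unstable loci have codimension at least two in `V`, so the invariant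
sections of `O(k)[l]` over `X_+` and over `X_-` are the same, namely the polynomials of bidegree
`(k, l)`; one matrix therefore gives a matrix factorization over `X_+` and one over `X_-`, and
these are all matrix factorizations whose bundle splits in this way. The two models differ in
their derived morphisms, which are computed by the Cech complex of the respective affine cover.
-/

open MvPolynomial

namespace LGCY

/-- The coordinates `x_1, …, x_6` (left) and `p_1, p_2` (right) on `V`. -/
abbrev Var : Type := Fin 6 ⊕ Fin 2
/-- The coordinate ring of `V`. -/
abbrev S : Type := MvPolynomial Var ℂ
/-- The function field of `V`; it contains the functions on every open chart. -/
abbrev K : Type := FractionRing S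

/-- Bidegrees (weight of `ℂ^*`, R-weight): `x_i` is an invariant section of `O(1)[0]`, and `p_j` of
`O(-3)[2]`. -/
def wt : Var → ℤ × ℤ := Sum.elim (fun _ => (1, 0)) (fun _ => (-3, 2))

/-- `P` has bidegree `k`, so that it is an invariant section of `O(k.1)[k.2]`. -/
abbrev BiHom (P : S) (k : ℤ × ℤ) : Prop := IsWeightedHomogeneous wt P k

/-- A graded matrix factorization of `W` with underlying bundle `⨁ i, O((deg i).1)[(deg i).2]`. The
entry `d a b` is the component from the summand `b` to the summand `a`; the differential has
R-weight one and square `W`. -/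
structure GMF (W : S) where
  ι : Type
  [fintype : Fintype ι]
  [decEq : DecidableEq ι]
  deg : ι → ℤ × ℤ
  d : Matrix ι ι S
  d_homog : ∀ a b, BiHom (d a b) (deg a - deg b + (0, 1))
  d_sq : d * d = W • (1 : Matrix ι ι S)

attribute [instance] GMF.fintype GMF.decEq

section Cech
variable {N : ℕ} (u : Fin N → Var) {W : S}

/-- In this section `u` lists coordinates, whose loci of non-vanishing are the open charts
`U_i = {u i ≠ 0}`. This is the function that is inverted on the intersection of the `U_i`, `i ∈ I`. -/
noncomputable def denom (I : Finset (Fin N)) : S := ∏ i ∈ I, X (u i)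

/-- `z` is a section of bidegree `k` over the intersection of the charts in `I`: `z = P / f ^ m` with
`f = denom u I` and `P` a polynomial of the matching bidegree. -/
def IsSection (I : Finset (Fin N)) (k : ℤ × ℤ) (z : K) : Prop :=
  ∃ (m : ℕ) (P : S), BiHom P (k + m • ∑ i ∈ I, wt (u i)) ∧
    z * algebraMap S K (denom u I) ^ m = algebraMap S K P

theorem denom_ne (I : Finset (Fin N)) : algebraMap S K (denom u I) ≠ 0 := by
  rw [Ne, FaithfulSMul.algebraMap_eq_zero_iff]
  exact Finset.prod_ne_zero_iff.2 fun _ _ => X_ne_zero _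

theorem denom_homog (I : Finset (Fin N)) : BiHom (denom u I) (∑ i ∈ I, wt (u i)) :=
  IsWeightedHomogeneous.prod _ _ _ fun _ _ => isWeightedHomogeneous_X _ _ _

theorem denom_pow_homog (I : Finset (Fin N)) (m : ℕ) :
    BiHom (denom u I ^ m) (m • ∑ i ∈ I, wt (u i)) := (denom_homog u I).pow m

theorem isSection_zero (I : Finset (Fin N)) (k : ℤ × ℤ) : IsSection u I k 0 :=
  ⟨0, 0, isWeightedHomogeneous_zero _ _ _, by simp⟩

theorem isSection_algebraMap (I : Finset (Fin N)) {k : ℤ × ℤ} {P : S} (h : BiHom P k) :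
    IsSection u I k (algebraMap S K P) := ⟨0, P, by simpa using h, by simp⟩

variable {u} in
theorem IsSection.add {I : Finset (Fin N)} {k : ℤ × ℤ} {z z' : K}
    (h : IsSection u I k z) (h' : IsSection u I k z') : IsSection u I k (z + z') := by
  obtain ⟨m, P, hP, e⟩ := h
  obtain ⟨m', P', hP', e'⟩ := h'
  refine ⟨m + m', P * denom u I ^ m' + P' * denom u I ^ m, ?_, ?_⟩
  · refine IsWeightedHomogeneous.add ?_ ?_
    · have := hP.mul (denom_pow_homog u I m')
      rwa [add_assoc, ← add_smul] at this
    · have := hP'.mul (denom_pow_homog u I m)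
      rwa [add_assoc, ← add_smul, add_comm m'] at this
  · simp only [map_add, map_mul, map_pow, ← e, ← e']
    ring

variable {u} in
theorem IsSection.neg {I : Finset (Fin N)} {k : ℤ × ℤ} {z : K}
    (h : IsSection u I k z) : IsSection u I k (-z) := by
  obtain ⟨m, P, hP, e⟩ := h
  refine ⟨m, -P, ?_, by rw [map_neg, ← e]; ring⟩
  exact (weightedHomogeneousSubmodule ℂ wt _).neg_mem hP

variable {u} in
theorem IsSection.mul {I : Finset (Fin N)} {k k' : ℤ × ℤ} {z z' : K}
    (h : IsSection u I k z) (h' : IsSection u I k' z') : IsSection u I (k + k') (z * z') := by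
  obtain ⟨m, P, hP, e⟩ := h
  obtain ⟨m', P', hP', e'⟩ := h'
  refine ⟨m + m', P * P', ?_, ?_⟩
  · have := hP.mul hP'
    rwa [add_add_add_comm, ← add_smul] at this
  · rw [map_mul, ← e, ← e']
    ring

variable {u} in
theorem IsSection.mono {I J : Finset (Fin N)} {k : ℤ × ℤ} {z : K}
    (h : IsSection u I k z) (hIJ : I ⊆ J) : IsSection u J k z := by
  obtain ⟨m, P, hP, e⟩ := h
  have hd : denom u J = denom u (J \ I) * denom u I := (Finset.prod_sdiff hIJ).symm
  refine ⟨m, P * denom u (J \ I) ^ m, ?_, ?_⟩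
  · have := hP.mul (denom_pow_homog u (J \ I) m)
    rwa [add_assoc, ← smul_add, add_comm (∑ i ∈ I, _), Finset.sum_sdiff hIJ] at this
  · rw [hd, map_mul, map_mul, map_pow, ← e]
    ring

variable {u} in
theorem IsSection.sum {I : Finset (Fin N)} {k : ℤ × ℤ} {α : Type} {s : Finset α} {z : α → K}
    (h : ∀ a ∈ s, IsSection u I k (z a)) : IsSection u I k (∑ a ∈ s, z a) := by
  classical
  induction s using Finset.induction_on with
  | empty => simpa using isSection_zero u I k
  | insert a s ha ih =>
    rw [Finset.sum_insert ha]
    exact (h _ (Finset.mem_insert_self _ _)).add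
      (ih fun b hb => h b (Finset.mem_insert_of_mem hb))

theorem even_weight (c : Var →₀ ℕ) : Even (Finsupp.weight wt c).2 := by
  rw [Finsupp.weight_apply, Finsupp.sum, Prod.snd_sum]
  refine Finset.even_sum _ fun i _ => ?_
  rcases i with i | i <;> simp [wt]

variable {u} in
theorem IsSection.eq_zero_of_odd {I : Finset (Fin N)} {k : ℤ × ℤ} {z : K}
    (h : IsSection u I k z) (hk : Odd k.2) : z = 0 := by
  obtain ⟨m, P, hP, e⟩ := h
  have hP0 : P = 0 := by
    ext c
    rw [coeff_zero]
    by_contra hc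
    have h1 := hP hc
    have h2 := even_weight c
    rw [h1, Prod.snd_add, Prod.smul_snd, Prod.snd_sum] at h2
    have h3 : Even (m • ∑ i ∈ I, (wt (u i)).2) := by
      have h4 : Even (∑ i ∈ I, (wt (u i)).2) := Finset.even_sum _ fun i _ => by
        rcases u i with i | i <;> simp [wt]
      rw [nsmul_eq_mul]
      exact h4.mul_left _
    exact (Int.not_even_iff_odd.2 (hk.add_even h3)) h2
  rw [hP0, map_zero] at e
  exact (mul_eq_zero.1 e).resolve_right (pow_ne_zero _ (denom_ne u I))


variable {N : ℕ}

/-- The number of elements of `I` before `i`. -/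
def pos (i : Fin N) (I : Finset (Fin N)) : ℕ := (I.filter (· < i)).card

/-- Families of matrices indexed by sets of charts; among these are the Cech cochains with values
in the sheaf of homomorphisms from `E` to `F`, see `IsCochain`. A cochain is indexed by the
intersections of distinct charts, listed in increasing order. -/
abbrev PreHom (N : ℕ) (E F : GMF W) : Type := Finset (Fin N) → Matrix F.ι E.ι K

/-- The differential of `E`, with entries in the function field. -/
noncomputable def dK (E : GMF W) : Matrix E.ι E.ι K := E.d.map (algebraMap S K)

/-- The sign `(-1)^l` on a summand `O(k)[l]`. -/
noncomputable def sgn (E : GMF W) : Matrix E.ι E.ι K :=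
  Matrix.diagonal fun a => (-1 : K) ^ (E.deg a).2

/-- The Cech differential. -/
noncomputable def delta {E F : GMF W} (φ : PreHom N E F) : PreHom N E F :=
  fun I => ∑ i ∈ I, (-1 : K) ^ pos i I • φ (I.erase i)

/-- The differential of the total Cech complex in degree `n`: the Cech differential plus the graded
commutator with the differentials of `E` and `F`. The sign `sgn F` makes the two anticommute. -/
noncomputable def D (n : ℤ) {E F : GMF W} (φ : PreHom N E F) : PreHom N E F :=
  fun I => sgn F * delta φ I + dK F * φ I - (-1 : K) ^ n • (φ I * dK E)

/-- Composition of cochains: the cup product, front face times back face. -/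
noncomputable def cup {E F G : GMF W} (ψ : PreHom N F G) (φ : PreHom N E F) : PreHom N E G :=
  fun I => ∑ i ∈ I, ψ (I.filter (· ≤ i)) * φ (I.filter (i ≤ ·))

/-- The identity, with value `1` on each chart. -/
noncomputable def one (N : ℕ) (E : GMF W) : PreHom N E E := fun I => if I.card = 1 then 1 else 0

/-- The cochains of total degree `n`: on an intersection of `q + 1` charts the value is a regular
homomorphism of R-weight `n - q`. -/
structure IsCochain (u : Fin N → Var) (n : ℤ) {E F : GMF W} (φ : PreHom N E F) : Prop where
  empty : φ ∅ = 0
  sect : ∀ I, I.Nonempty → ∀ a b,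
    IsSection u I (F.deg a - E.deg b + (0, n - (I.card - 1))) (φ I a b)

section
variable {E F G H : GMF W}

theorem sgn_sq : sgn E * sgn E = 1 := by
  rw [sgn, Matrix.diagonal_mul_diagonal, ← Matrix.diagonal_one]
  congr 1
  funext a
  rw [← mul_zpow]; simp

theorem dK_apply (a b) : dK E a b = algebraMap S K (E.d a b) := rfl

theorem dK_sq : dK E * dK E = algebraMap S K W • (1 : Matrix E.ι E.ι K) := by
  rw [dK, ← Matrix.map_mul, E.d_sq]
  ext a b
  simp [Matrix.one_apply, apply_ite (algebraMap S K)]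

theorem cup_one {φ : PreHom N E F} (h : φ ∅ = 0) : cup φ (one N E) = φ := by
  funext I
  rcases I.eq_empty_or_nonempty with rfl | hI
  · simp [cup, h]
  have hm := I.max'_mem hI
  rw [cup, Finset.sum_eq_single_of_mem _ hm]
  · have h1 : I.filter (I.max' hI ≤ ·) = {I.max' hI} := by
      ext j
      simp only [Finset.mem_filter, Finset.mem_singleton]
      exact ⟨fun h => le_antisymm (I.le_max' _ h.1) h.2, by rintro rfl; exact ⟨hm, le_rfl⟩⟩
    have h2 : I.filter (· ≤ I.max' hI) = I :=
      Finset.filter_true_of_mem fun j hj => I.le_max' _ hj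
    rw [h1, h2]; simp [one]
  · intro i hi hne
    have : (I.filter (i ≤ ·)).card ≠ 1 := by
      rw [Ne, Finset.card_eq_one]
      rintro ⟨a, ha⟩
      have h1 : i ∈ I.filter (i ≤ ·) := by simp [hi]
      have h2 : I.max' hI ∈ I.filter (i ≤ ·) := by simp [hm, I.le_max' _ hi]
      rw [ha, Finset.mem_singleton] at h1 h2
      exact hne (h1.trans h2.symm)
    simp [one, this]

theorem one_cup {φ : PreHom N E F} (h : φ ∅ = 0) : cup (one N F) φ = φ := by
  funext I
  rcases I.eq_empty_or_nonempty with rfl | hI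
  · simp [cup, h]
  have hm := I.min'_mem hI
  rw [cup, Finset.sum_eq_single_of_mem _ hm]
  · have h1 : I.filter (· ≤ I.min' hI) = {I.min' hI} := by
      ext j
      simp only [Finset.mem_filter, Finset.mem_singleton]
      exact ⟨fun h => le_antisymm h.2 (I.min'_le _ h.1), by rintro rfl; exact ⟨hm, le_rfl⟩⟩
    have h2 : I.filter (I.min' hI ≤ ·) = I :=
      Finset.filter_true_of_mem fun j hj => I.min'_le _ hj
    rw [h1, h2]; simp [one]
  · intro i hi hne
    have : (I.filter (· ≤ i)).card ≠ 1 := by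
      rw [Ne, Finset.card_eq_one]
      rintro ⟨a, ha⟩
      have h1 : i ∈ I.filter (· ≤ i) := by simp [hi]
      have h2 : I.min' hI ∈ I.filter (· ≤ i) := by simp [hm, I.min'_le _ hi]
      rw [ha, Finset.mem_singleton] at h1 h2
      exact hne (h1.trans h2.symm)
    simp [one, this]

theorem cup_assoc (χ : PreHom N G H) (ψ : PreHom N F G) (φ : PreHom N E F) :
    cup (cup χ ψ) φ = cup χ (cup ψ φ) := by
  funext I
  symm
  simp only [cup, Matrix.mul_sum, Matrix.sum_mul]
  rw [Finset.sum_sigma', Finset.sum_sigma']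
  refine Finset.sum_bij' (fun x _ => ⟨x.2, x.1⟩) (fun x _ => ⟨x.2, x.1⟩) ?_ ?_ ?_ ?_ ?_
  · simp only [Finset.mem_sigma, Finset.mem_filter]; tauto
  · simp only [Finset.mem_sigma, Finset.mem_filter]; tauto
  · simp
  · simp
  · rintro ⟨i, j⟩ h
    simp only [Finset.mem_sigma, Finset.mem_filter] at h
    have e1 : (I.filter (i ≤ ·)).filter (· ≤ j) = (I.filter (· ≤ j)).filter (i ≤ ·) :=
      Finset.filter_comm ..
    have e2 : (I.filter (i ≤ ·)).filter (j ≤ ·) = I.filter (j ≤ ·) := by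
      ext k; simp only [Finset.mem_filter]
      exact ⟨fun a => ⟨a.1.1, a.2⟩, fun a => ⟨⟨a.1, h.2.2.trans a.2⟩, a.2⟩⟩
    have e3 : (I.filter (· ≤ j)).filter (· ≤ i) = I.filter (· ≤ i) := by
      ext k; simp only [Finset.mem_filter]
      exact ⟨fun a => ⟨a.1.1, a.2⟩, fun a => ⟨⟨a.1, a.2.trans h.2.2⟩, a.2⟩⟩
    simp only [e1, e2, e3, Matrix.mul_assoc]

theorem sum_cuts {M : Type} [AddCommGroup M] [Module K M] (I : Finset (Fin N))
    (T : Finset (Fin N) → Finset (Fin N) → M) :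
    ∑ i ∈ I, (-1 : K) ^ pos i I • (T (I.filter (· < i)) (I.filter (i ≤ ·)) +
      T (I.filter (· ≤ i)) (I.filter (i < ·))) = T ∅ I - (-1 : K) ^ I.card • T I ∅ := by
  induction I using Finset.induction_on_max generalizing T with
  | empty => simp
  | insert a J hJ ih =>
    have ha : a ∉ J := fun h => lt_irrefl _ (hJ a h)
    have f1 : (insert a J).filter (· < a) = J := by
      ext k; simp only [Finset.mem_filter, Finset.mem_insert]
      constructor
      · rintro ⟨rfl | h, h'⟩
        · exact absurd h' (lt_irrefl _)
        · exact h
      · exact fun h => ⟨.inr h, hJ k h⟩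
    have f2 : (insert a J).filter (a ≤ ·) = {a} := by
      ext k; simp only [Finset.mem_filter, Finset.mem_insert, Finset.mem_singleton]
      constructor
      · rintro ⟨rfl | h, h'⟩
        · rfl
        · exact absurd (hJ k h) (not_lt.2 h')
      · rintro rfl; exact ⟨.inl rfl, le_rfl⟩
    have f3 : (insert a J).filter (· ≤ a) = insert a J := by
      refine Finset.filter_true_of_mem fun k hk => ?_
      rcases Finset.mem_insert.1 hk with rfl | h
      · exact le_rfl
      · exact (hJ k h).le
    have f4 : (insert a J).filter (a < ·) = ∅ := by
      refine Finset.filter_false_of_mem fun k hk => not_lt.2 ?_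
      rcases Finset.mem_insert.1 hk with rfl | h
      · exact le_rfl
      · exact (hJ k h).le
    rw [Finset.sum_insert ha, pos, f1, f2, f3, f4]
    have := ih (fun L R => T L (insert a R))
    rw [Finset.sum_congr rfl (g := fun i => (-1 : K) ^ pos i J •
      (T (J.filter (· < i)) (insert a (J.filter (i ≤ ·))) +
      T (J.filter (· ≤ i)) (insert a (J.filter (i < ·)))))]
    · rw [this, Finset.card_insert_of_notMem ha, pow_succ]
      simp only [insert_empty_eq, smul_add, mul_neg, mul_one, neg_smul, sub_neg_eq_add]
      abel
    · intro i hi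
      have hia := hJ i hi
      simp [pos, Finset.filter_insert, hia, hia.le, not_lt.2 hia.le, not_le.2 hia]


theorem delta_cup (ψ : PreHom N F G) (φ : PreHom N E F) (hψ : ψ ∅ = 0) (hφ : φ ∅ = 0)
    (I : Finset (Fin N)) :
    delta (cup ψ φ) I = ∑ i ∈ I, delta ψ (I.filter (· ≤ i)) * φ (I.filter (i ≤ ·)) +
      ∑ i ∈ I, (-1 : K) ^ pos i I • (ψ (I.filter (· ≤ i)) * delta φ (I.filter (i ≤ ·))) := by
  have hcut := sum_cuts I (fun L R => ψ L * φ R)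
  simp only [hψ, hφ, Matrix.zero_mul, Matrix.mul_zero, smul_zero, sub_zero] at hcut
  have hR1 : ∀ i ∈ I, delta ψ (I.filter (· ≤ i)) * φ (I.filter (i ≤ ·)) =
      (-1 : K) ^ pos i I • (ψ (I.filter (· < i)) * φ (I.filter (i ≤ ·))) +
      ∑ j ∈ I.filter (· < i), (-1 : K) ^ pos j I •
        (ψ ((I.erase j).filter (· ≤ i)) * φ ((I.erase j).filter (i ≤ ·))) := by
    intro i hi
    have e : I.filter (· ≤ i) = insert i (I.filter (· < i)) := by
      ext k; simp only [Finset.mem_filter, Finset.mem_insert, le_iff_lt_or_eq]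
      constructor
      · rintro ⟨h, h' | h'⟩ <;> tauto
      · rintro (rfl | h) <;> tauto
    have hp : ∀ j, j ≤ i → pos j (I.filter (· ≤ i)) = pos j I := by
      intro j hj
      rw [pos, pos, Finset.filter_filter]
      congr 1
      refine Finset.filter_congr fun k _ => ?_
      exact ⟨fun h => h.2, fun h => ⟨h.le.trans hj, h⟩⟩
    have h1 : delta ψ (I.filter (· ≤ i)) = (-1 : K) ^ pos i I • ψ (I.filter (· < i)) +
        ∑ j ∈ I.filter (· < i), (-1 : K) ^ pos j I • ψ ((I.erase j).filter (· ≤ i)) := by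
      have h2 : (I.filter (· ≤ i)).erase i = I.filter (· < i) := by
        rw [e, Finset.erase_insert (by simp)]
      rw [delta, ← Finset.add_sum_erase _ _ (show i ∈ I.filter (· ≤ i) by simp [hi]), h2,
        hp i le_rfl]
      congr 1
      refine Finset.sum_congr rfl fun j hj => ?_
      rw [Finset.mem_filter] at hj
      rw [hp j hj.2.le, Finset.filter_erase]
    rw [h1, Matrix.add_mul, Matrix.smul_mul, Matrix.sum_mul]
    congr 1
    refine Finset.sum_congr rfl fun j hj => ?_
    rw [Finset.mem_filter] at hj
    rw [Matrix.smul_mul, Finset.filter_erase (i ≤ ·),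
      Finset.erase_eq_of_notMem (s := I.filter (i ≤ ·)) (by simp [hj.2])]
  have hR2 : ∀ i ∈ I, (-1 : K) ^ pos i I •
        (ψ (I.filter (· ≤ i)) * delta φ (I.filter (i ≤ ·))) =
      (-1 : K) ^ pos i I • (ψ (I.filter (· ≤ i)) * φ (I.filter (i < ·))) +
      ∑ j ∈ I.filter (i < ·), (-1 : K) ^ pos j I •
        (ψ ((I.erase j).filter (· ≤ i)) * φ ((I.erase j).filter (i ≤ ·))) := by
    intro i hi
    have e : I.filter (i ≤ ·) = insert i (I.filter (i < ·)) := by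
      ext k; simp only [Finset.mem_filter, Finset.mem_insert, le_iff_lt_or_eq]
      constructor
      · rintro ⟨h, h' | h'⟩ <;> tauto
      · rintro (rfl | h) <;> tauto
    have hp : ∀ j, i ≤ j → pos i I + pos j (I.filter (i ≤ ·)) = pos j I := by
      intro j hj
      rw [pos, pos, pos, ← Finset.card_union_of_disjoint]
      · congr 1
        ext k
        simp only [Finset.mem_union, Finset.mem_filter]
        constructor
        · rintro (h | h)
          · exact ⟨h.1, h.2.trans_le hj⟩
          · exact ⟨h.1.1, h.2⟩
        · intro h
          rcases lt_or_ge k i with h' | h'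
          · exact .inl ⟨h.1, h'⟩
          · exact .inr ⟨⟨h.1, h'⟩, h.2⟩
      · rw [Finset.disjoint_left]
        intro k hk hk'
        simp only [Finset.mem_filter] at hk hk'
        exact absurd hk.2 (not_lt.2 hk'.1.2)
    have h1 : (-1 : K) ^ pos i I • delta φ (I.filter (i ≤ ·)) =
        (-1 : K) ^ pos i I • φ (I.filter (i < ·)) +
        ∑ j ∈ I.filter (i < ·), (-1 : K) ^ pos j I • φ ((I.erase j).filter (i ≤ ·)) := by
      have h2 : (I.filter (i ≤ ·)).erase i = I.filter (i < ·) := by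
        rw [e, Finset.erase_insert (by simp)]
      rw [delta, Finset.smul_sum,
        ← Finset.add_sum_erase _ _ (show i ∈ I.filter (i ≤ ·) by simp [hi]), h2,
        smul_smul, ← pow_add, hp i le_rfl]
      congr 1
      refine Finset.sum_congr rfl fun j hj => ?_
      rw [Finset.mem_filter] at hj
      rw [smul_smul, ← pow_add, hp j hj.2.le, Finset.filter_erase]
    rw [← Matrix.mul_smul, h1, Matrix.mul_add, Matrix.mul_smul, Matrix.mul_sum]
    congr 1
    refine Finset.sum_congr rfl fun j hj => ?_
    rw [Finset.mem_filter] at hj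
    rw [Matrix.mul_smul, Finset.filter_erase (· ≤ i),
      Finset.erase_eq_of_notMem (s := I.filter (· ≤ i)) (by simp [hj.2])]
  rw [Finset.sum_congr rfl hR1, Finset.sum_congr rfl hR2, Finset.sum_add_distrib,
    Finset.sum_add_distrib, add_add_add_comm, ← Finset.sum_add_distrib]
  simp only [← smul_add]
  rw [hcut, zero_add, ← Finset.sum_add_distrib]
  have hL : delta (cup ψ φ) I = ∑ i ∈ I, ∑ j ∈ I.erase i, (-1 : K) ^ pos j I •
        (ψ ((I.erase j).filter (· ≤ i)) * φ ((I.erase j).filter (i ≤ ·))) := by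
    simp only [delta, cup, Finset.smul_sum]
    refine Finset.sum_comm' fun i j => ?_
    simp only [Finset.mem_erase]
    tauto
  rw [hL]
  refine Finset.sum_congr rfl fun i hi => ?_
  rw [← Finset.sum_union]
  · refine Finset.sum_congr ?_ fun _ _ => rfl
    ext k
    simp only [Finset.mem_erase, Finset.mem_union, Finset.mem_filter, ne_iff_lt_or_gt]
    tauto
  · rw [Finset.disjoint_left]
    intro k hk hk'
    simp only [Finset.mem_filter] at hk hk'
    exact lt_asymm hk.2 hk'.2

theorem IsCochain.sgn_mul {u : Fin N → Var} {n : ℤ} {φ : PreHom N E F} (h : IsCochain u n φ)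
    {I : Finset (Fin N)} (hI : I.Nonempty) :
    sgn F * φ I = (-1 : K) ^ (n - (I.card - 1)) • (φ I * sgn E) := by
  ext a b
  rw [sgn, sgn, Matrix.diagonal_mul, Matrix.smul_apply, Matrix.mul_diagonal, smul_eq_mul]
  rcases Int.even_or_odd ((F.deg a).2 - (E.deg b).2 + (n - (I.card - 1))) with he | ho
  · have : (-1 : K) ^ (F.deg a).2 = (-1 : K) ^ (n - ((I.card : ℤ) - 1)) * (-1 : K) ^ (E.deg b).2 := by
      rw [← zpow_add₀ (by norm_num)]
      have : (F.deg a).2 = ((F.deg a).2 - (E.deg b).2 + (n - (I.card - 1))) +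
          ((n - (I.card - 1)) + (E.deg b).2) - 2 * (n - (I.card - 1)) := by ring
      rw [this, zpow_sub₀ (by norm_num), zpow_add₀ (by norm_num), he.neg_one_zpow, one_mul,
        (even_two_mul _).neg_one_zpow, div_one]
    rw [this]; ring
  · rw [(h.sect I hI a b).eq_zero_of_odd (by simpa using ho)]
    simp

theorem D_cup {u : Fin N → Var} {n m : ℤ} {ψ : PreHom N F G} {φ : PreHom N E F}
    (hψ : IsCochain u n ψ) (hφ : IsCochain u m φ) :
    D (n + m) (cup ψ φ) = cup (D n ψ) φ + (-1 : K) ^ n • cup ψ (D m φ) := by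
  funext I
  have key : ∀ i ∈ I, (-1 : K) ^ pos i I •
      (sgn G * (ψ (I.filter (· ≤ i)) * delta φ (I.filter (i ≤ ·)))) =
      (-1 : K) ^ n • (ψ (I.filter (· ≤ i)) * (sgn F * delta φ (I.filter (i ≤ ·)))) := by
    intro i hi
    have hc : (I.filter (· ≤ i)).card = pos i I + 1 := by
      have : I.filter (· ≤ i) = insert i (I.filter (· < i)) := by
        ext k; simp only [Finset.mem_filter, Finset.mem_insert, le_iff_lt_or_eq]
        constructor
        · rintro ⟨h, h' | h'⟩ <;> tauto
        · rintro (rfl | h) <;> tauto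
      rw [this, Finset.card_insert_of_notMem (by simp), pos]
    have := hψ.sgn_mul (I := I.filter (· ≤ i)) ⟨i, by simp [hi]⟩
    rw [← Matrix.mul_assoc, ← Matrix.mul_assoc, this, Matrix.smul_mul, smul_smul, hc,
      ← zpow_natCast, ← zpow_add₀ (by norm_num)]
    congr 2
    push_cast; ring
  have L1 : D (n + m) (cup ψ φ) I = ∑ i ∈ I,
      (sgn G * (delta ψ (I.filter (· ≤ i)) * φ (I.filter (i ≤ ·))) +
       (-1 : K) ^ n • (ψ (I.filter (· ≤ i)) * (sgn F * delta φ (I.filter (i ≤ ·)))) +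
       dK G * (ψ (I.filter (· ≤ i)) * φ (I.filter (i ≤ ·))) -
       (-1 : K) ^ (n + m) • (ψ (I.filter (· ≤ i)) * φ (I.filter (i ≤ ·)) * dK E)) := by
    rw [D, delta_cup ψ φ hψ.empty hφ.empty, cup, Matrix.mul_add, Matrix.mul_sum,
      Matrix.mul_sum, Matrix.mul_sum, Matrix.sum_mul, Finset.smul_sum]
    simp only [Matrix.mul_smul]
    rw [Finset.sum_congr rfl key, ← Finset.sum_add_distrib, ← Finset.sum_add_distrib,
      ← Finset.sum_sub_distrib]
  rw [L1, Pi.add_apply, Pi.smul_apply, cup, cup, Finset.smul_sum, ← Finset.sum_add_distrib]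
  refine Finset.sum_congr rfl fun i hi => ?_
  simp only [D, Matrix.add_mul, Matrix.mul_add, Matrix.sub_mul, Matrix.mul_sub, smul_add,
    smul_sub, Matrix.smul_mul, Matrix.mul_smul, Matrix.mul_assoc, smul_smul]
  rw [← zpow_add₀ (by norm_num)]
  abel

theorem IsCochain.cup {u : Fin N → Var} {n m : ℤ} {ψ : PreHom N F G} {φ : PreHom N E F}
    (hψ : IsCochain u n ψ) (hφ : IsCochain u m φ) : IsCochain u (n + m) (cup ψ φ) := by
  refine ⟨by simp [LGCY.cup], fun I hI a c => ?_⟩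
  rw [LGCY.cup, Matrix.sum_apply]
  refine IsSection.sum fun i hi => ?_
  rw [Matrix.mul_apply]
  refine IsSection.sum fun b _ => ?_
  have h1 := (hψ.sect (I.filter (· ≤ i)) ⟨i, by simp [hi]⟩ a b).mono (Finset.filter_subset _ I)
  have h2 := (hφ.sect (I.filter (i ≤ ·)) ⟨i, by simp [hi]⟩ b c).mono (Finset.filter_subset _ I)
  have hc : (I.filter (· ≤ i)).card + (I.filter (i ≤ ·)).card = I.card + 1 := by
    rw [← Finset.card_union_add_card_inter]
    congr 1
    · congr 1
      ext k; simp only [Finset.mem_union, Finset.mem_filter]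
      have := le_total k i
      tauto
    · rw [Finset.card_eq_one]
      refine ⟨i, ?_⟩
      ext k; simp only [Finset.mem_inter, Finset.mem_filter, Finset.mem_singleton]
      constructor
      · rintro ⟨h, h'⟩; exact le_antisymm h.2 h'.2
      · rintro rfl; exact ⟨⟨hi, le_rfl⟩, hi, le_rfl⟩
  convert h1.mul h2 using 1
  have hc' : ((I.filter (· ≤ i)).card : ℤ) + (I.filter (i ≤ ·)).card = I.card + 1 := by
    exact_mod_cast hc
  ext
  · simp
  · simp only [Prod.snd_add, Prod.snd_sub]
    linarith

theorem IsCochain.add {u : Fin N → Var} {n : ℤ} {φ ψ : PreHom N E F}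
    (hφ : IsCochain u n φ) (hψ : IsCochain u n ψ) : IsCochain u n (φ + ψ) :=
  ⟨by simp [hφ.empty, hψ.empty], fun I hI a b => (hφ.sect I hI a b).add (hψ.sect I hI a b)⟩

theorem IsCochain.neg {u : Fin N → Var} {n : ℤ} {φ : PreHom N E F}
    (hφ : IsCochain u n φ) : IsCochain u n (-φ) :=
  ⟨by simp [hφ.empty], fun I hI a b => (hφ.sect I hI a b).neg⟩

theorem IsCochain.zero {u : Fin N → Var} {n : ℤ} : IsCochain u n (0 : PreHom N E F) :=
  ⟨rfl, fun I _ _ _ => isSection_zero u I _⟩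

theorem IsCochain.one {u : Fin N → Var} : IsCochain u 0 (one N E) := by
  refine ⟨by simp [LGCY.one], fun I hI a b => ?_⟩
  rw [LGCY.one]
  split_ifs with h
  · rw [Matrix.one_apply]
    split_ifs with hab
    · subst hab
      rw [← map_one (algebraMap S K)]
      refine isSection_algebraMap u I ?_
      have h0 : E.deg a - E.deg a + (0, 0 - ((I.card : ℤ) - 1)) = 0 := by simp [h]
      rw [h0]
      exact isWeightedHomogeneous_one ℂ wt
    · exact isSection_zero u I _
  · exact isSection_zero u I _

theorem D_add (n : ℤ) (φ ψ : PreHom N E F) : D n (φ + ψ) = D n φ + D n ψ := by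
  funext I
  simp only [D, delta, Pi.add_apply, smul_add, Finset.sum_add_distrib, Matrix.mul_add,
    Matrix.add_mul]
  abel

theorem D_neg (n : ℤ) (φ : PreHom N E F) : D n (-φ) = -D n φ := by
  funext I
  simp only [D, delta, Pi.neg_apply, smul_neg, Finset.sum_neg_distrib, Matrix.mul_neg,
    Matrix.neg_mul]
  abel

theorem D_zero (n : ℤ) : D n (0 : PreHom N E F) = 0 := by
  simpa using D_add n (0 : PreHom N E F) 0

theorem delta_one : delta (one N E) = 0 := by
  funext I
  rw [delta, Pi.zero_apply]
  by_cases h : I.card = 2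
  · obtain ⟨a, b, hab, rfl⟩ := Finset.card_eq_two.1 h
    wlog hlt : a < b generalizing a b
    · rw [Finset.pair_comm]
      exact this b a hab.symm (by rwa [Finset.pair_comm]) (lt_of_le_of_ne (not_lt.1 hlt) hab.symm)
    have ea : ({a, b} : Finset (Fin N)).erase a = {b} := by
      rw [Finset.erase_insert (by simpa using hab)]
    have eb : ({a, b} : Finset (Fin N)).erase b = {a} := by
      rw [Finset.pair_comm, Finset.erase_insert (by simpa using hab.symm)]
    rw [Finset.sum_pair hab, ea, eb]
    simp [one, pos, Finset.filter_insert, Finset.filter_singleton, hlt, not_lt.2 hlt.le]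
  · refine Finset.sum_eq_zero fun i hi => ?_
    have := Finset.card_erase_add_one hi
    rw [one, if_neg (by omega), smul_zero]

theorem D_one : D 0 (one N E) = 0 := by
  funext I
  simp only [D, delta_one, Pi.zero_apply, Matrix.mul_zero, zero_add, zpow_zero, one_smul, one]
  split_ifs <;> simp

theorem cup_add (ψ : PreHom N F G) (φ φ' : PreHom N E F) :
    cup ψ (φ + φ') = cup ψ φ + cup ψ φ' := by
  funext I; simp [cup, Matrix.mul_add, Finset.sum_add_distrib]

theorem add_cup (ψ ψ' : PreHom N F G) (φ : PreHom N E F) :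
    cup (ψ + ψ') φ = cup ψ φ + cup ψ' φ := by
  funext I; simp [cup, Matrix.add_mul, Finset.sum_add_distrib]

theorem cup_zero (ψ : PreHom N F G) : cup ψ (0 : PreHom N E F) = 0 := by
  funext I; simp [cup]

theorem zero_cup (φ : PreHom N E F) : cup (0 : PreHom N F G) φ = 0 := by
  funext I; simp [cup]


end
end Cech

section Category
variable {N : ℕ} (u : Fin N → Var) {W : S}

/-- Closed elements of degree zero of the total Cech complex. -/
def Cocycle (E F : GMF W) : Type := {φ : PreHom N E F // IsCochain u 0 φ ∧ D 0 φ = 0}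

/-- Two cocycles are identified when they differ by a coboundary. -/
def homotopic (E F : GMF W) : Setoid (Cocycle u E F) where
  r φ ψ := ∃ h : PreHom N E F, IsCochain u (-1) h ∧ φ.1 - ψ.1 = D (-1) h
  iseqv := by
    refine ⟨fun φ => ⟨0, .zero, by rw [D_zero, sub_self]⟩, ?_, ?_⟩
    · rintro φ ψ ⟨h, hh, e⟩
      exact ⟨-h, hh.neg, by rw [D_neg, ← e, neg_sub]⟩
    · rintro φ ψ χ ⟨h, hh, e⟩ ⟨h', hh', e'⟩
      exact ⟨h + h', hh.add hh', by rw [D_add, ← e, ← e', sub_add_sub_cancel]⟩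

variable {u} in
noncomputable def Cocycle.cup {E F G : GMF W} (ψ : Cocycle u F G) (φ : Cocycle u E F) :
    Cocycle u E G :=
  ⟨LGCY.cup ψ.1 φ.1, ψ.2.1.cup φ.2.1, by
    have := D_cup ψ.2.1 φ.2.1
    rwa [φ.2.2, ψ.2.2, cup_zero, zero_cup, smul_zero, add_zero, add_zero] at this⟩

/-- The category of graded matrix factorizations over the quotient stack covered by the charts
`{u i ≠ 0}`: the homotopy category of the dg category in which the complex of morphisms from `E`
to `F` is the complex of derived global sections of the sheaf of homomorphisms, in Cech form.
Thus a morphism is a class in degree-zero cohomology. (Objects with split bundle, a full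
subcategory of the one for all bundles.) -/
structure DMF {N : ℕ} (u : Fin N → Var) (W : S) where
  of ::
  toGMF : GMF W

noncomputable instance : CategoryTheory.Category (DMF u W) where
  Hom E F := Quotient (homotopic u E.toGMF F.toGMF)
  id E := Quotient.mk _ ⟨one N E.toGMF, .one, D_one⟩
  comp f g := Quotient.map₂ (fun φ ψ => Cocycle.cup ψ φ) (by
    rintro φ φ' ⟨h, hh, e⟩ ψ ψ' ⟨k, hk, e'⟩
    refine ⟨LGCY.cup k φ.1 + LGCY.cup ψ'.1 h, ?_, ?_⟩
    · exact IsCochain.add (add_zero (-1 : ℤ) ▸ hk.cup φ.2.1) (zero_add (-1 : ℤ) ▸ ψ'.2.1.cup hh)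
    · have h1 := D_cup hk φ.2.1
      have h2 := D_cup ψ'.2.1 hh
      rw [φ.2.2, cup_zero, smul_zero, add_zero, add_zero] at h1
      rw [ψ'.2.2, zero_cup, zero_add, zero_add, zpow_zero, one_smul] at h2
      rw [D_add, h1, h2, ← e, ← e', sub_eq_add_neg ψ.1, sub_eq_add_neg φ.1, add_cup, cup_add]
      have h3 : LGCY.cup (-ψ'.1) φ.1 = -LGCY.cup ψ'.1 φ.1 := by
        rw [eq_neg_iff_add_eq_zero, ← add_cup, neg_add_cancel, zero_cup]
      have h4 : LGCY.cup ψ'.1 (-φ'.1) = -LGCY.cup ψ'.1 φ'.1 := by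
        rw [eq_neg_iff_add_eq_zero, ← cup_add, neg_add_cancel, cup_zero]
      rw [h3, h4]
      change LGCY.cup ψ.1 φ.1 - LGCY.cup ψ'.1 φ'.1 = _
      abel) f g
  id_comp f := by
    induction f using Quotient.inductionOn with | _ φ =>
    exact congrArg (Quotient.mk _) (Subtype.ext (cup_one φ.2.1.empty))
  comp_id f := by
    induction f using Quotient.inductionOn with | _ φ =>
    exact congrArg (Quotient.mk _) (Subtype.ext (one_cup φ.2.1.empty))
  assoc f g h := by
    induction f using Quotient.inductionOn with | _ φ =>
    induction g using Quotient.inductionOn with | _ ψ =>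
    induction h using Quotient.inductionOn with | _ χ =>
    exact congrArg (Quotient.mk _) (Subtype.ext (cup_assoc χ.1 ψ.1 φ.1).symm)

end Category

/-- The cover of `X_+` by the loci `{x_i ≠ 0}`. -/
def chartsPlus : Fin 6 → Var := Sum.inl
/-- The cover of `X_-` by the loci `{p_j ≠ 0}`. -/
def chartsMinus : Fin 2 → Var := Sum.inr

section Koszul
variable {r : ℕ} {R : Type} [CommRing R] (a b : Fin r → R)

/-- The operator `a ∧ (-) + b ∨ (-)` (exterior product with the vector `a`, contraction with the
covector `b`) on an exterior algebra with basis `e_I`, `I` a subset of `{1, …, r}`. The entry at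
`J`, `I` is the coefficient of `e_J` in the image of `e_I`. The set `symmDiff I {i}` is `I ∖ {i}` if
`i ∈ I` and `I ∪ {i}` otherwise. -/
def koszul : Matrix (Finset (Fin r)) (Finset (Fin r)) R := fun J I =>
  ∑ i, if J = symmDiff I {i} then
    (-1) ^ pos i I * (if i ∈ I then b i else a i) else 0

theorem koszul_sq : koszul a b * koszul a b = (∑ i, a i * b i) • 1 := by
  ext J I
  let t : Fin r → Fin r → R := fun i j =>
    (-1) ^ pos j (symmDiff I {i}) * (if j ∈ symmDiff I {i} then b j else a j) *
      ((-1) ^ pos i I * (if i ∈ I then b i else a i))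
  have h1 : (koszul a b * koszul a b) J I =
      ∑ i, ∑ j, if J = symmDiff (symmDiff I {i}) {j} then t i j else 0 := by
    have h0 : ∀ L, koszul a b J L * koszul a b L I =
        ∑ i, if L = symmDiff I {i} then koszul a b J L * ((-1) ^ pos i I *
          (if i ∈ I then b i else a i)) else 0 := by
      intro L
      conv_lhs => rw [koszul.eq_def a b L I]
      rw [Finset.mul_sum]
      exact Finset.sum_congr rfl fun i _ => by rw [mul_ite, mul_zero]
    rw [Matrix.mul_apply, Finset.sum_congr rfl fun L _ => h0 L]
    rw [Finset.sum_comm]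
    refine Finset.sum_congr rfl fun i _ => ?_
    rw [Finset.sum_ite_eq' Finset.univ (symmDiff I {i}), if_pos (Finset.mem_univ _), koszul,
      Finset.sum_mul]
    refine Finset.sum_congr rfl fun j _ => ?_
    rw [ite_mul, zero_mul]
  have hpos : ∀ i j : Fin r, i < j → pos i (symmDiff I {j}) = pos i I := by
    intro i j hij
    rw [pos, pos]
    congr 1
    ext k
    simp only [Finset.mem_filter, Finset.mem_symmDiff, Finset.mem_singleton]
    constructor
    · rintro ⟨h | h, h'⟩
      · exact ⟨h.1, h'⟩
      · exact absurd (h.1 ▸ h') (not_lt.2 hij.le)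
    · rintro ⟨h, h'⟩
      exact ⟨.inl ⟨h, by rintro rfl; exact absurd h' (not_lt.2 hij.le)⟩, h'⟩
  have hpos' : ∀ i j : Fin r, i < j → (-1 : R) ^ pos j (symmDiff I {i}) = -(-1) ^ pos j I := by
    intro i j hij
    by_cases hi : i ∈ I
    · have e : I.filter (· < j) = insert i ((symmDiff I {i}).filter (· < j)) := by
        ext k
        simp only [Finset.mem_filter, Finset.mem_symmDiff, Finset.mem_singleton,
          Finset.mem_insert]
        by_cases hk : k = i
        · subst hk; simp [hi, hij]
        · simp [hk]
      rw [pos, pos, e, Finset.card_insert_of_notMem (by simp [Finset.mem_symmDiff, hi]), pow_succ]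
      ring
    · have e : (symmDiff I {i}).filter (· < j) = insert i (I.filter (· < j)) := by
        ext k
        simp only [Finset.mem_filter, Finset.mem_symmDiff, Finset.mem_singleton,
          Finset.mem_insert]
        by_cases hk : k = i
        · subst hk; simp [hi, hij]
        · simp [hk]
      rw [pos, pos, e, Finset.card_insert_of_notMem (by simp [hi]), pow_succ]
      ring
  have hmem : ∀ i j : Fin r, i ≠ j → (j ∈ symmDiff I {i} ↔ j ∈ I) := by
    intro i j hij
    simp [Finset.mem_symmDiff, hij.symm]
  have hanti : ∀ i j, i < j → t i j = -t j i := by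
    intro i j hij
    simp only [t, hmem i j hij.ne, hmem j i hij.ne', hpos i j hij, hpos' i j hij]
    ring
  have hdiag : ∀ i, t i i = a i * b i := by
    intro i
    have e : pos i (symmDiff I {i}) = pos i I := by
      rw [pos, pos]
      congr 1
      ext k
      simp only [Finset.mem_filter, Finset.mem_symmDiff, Finset.mem_singleton]
      constructor
      · rintro ⟨h | h, h'⟩
        · exact ⟨h.1, h'⟩
        · exact absurd h' (by simp [h.1])
      · rintro ⟨h, h'⟩
        exact ⟨.inl ⟨h, h'.ne⟩, h'⟩
    have s : ((-1 : R) ^ pos i I) * (-1) ^ pos i I = 1 := by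
      rw [← mul_pow]; simp
    by_cases hi : i ∈ I
    · simp only [t, e, Finset.mem_symmDiff, hi, Finset.mem_singleton, not_true_eq_false,
        and_false, or_false, if_true, if_false]
      linear_combination a i * b i * s
    · simp only [t, e, Finset.mem_symmDiff, hi, Finset.mem_singleton, not_false_eq_true,
        and_self, false_and, false_or, if_true, if_false]
      linear_combination a i * b i * s
  rw [h1]
  have hsymm : ∀ i j : Fin r, symmDiff (symmDiff I {i}) {j} = symmDiff (symmDiff I {j}) {i} :=
    fun i j => by rw [symmDiff_assoc, symmDiff_assoc, symmDiff_comm ({i} : Finset (Fin r))]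
  have h2 : ∀ i, (∑ j, if J = symmDiff (symmDiff I {i}) {j} then t i j else 0) =
      (if J = I then a i * b i else 0) +
        ((∑ j, if i < j ∧ J = symmDiff (symmDiff I {i}) {j} then t i j else 0) +
        ∑ j, if j < i ∧ J = symmDiff (symmDiff I {i}) {j} then t i j else 0) := by
    intro i
    rw [← Finset.sum_add_distrib, ← Finset.add_sum_erase _ _ (Finset.mem_univ i), hdiag,
      symmDiff_symmDiff_cancel_right]
    congr 1
    rw [← Finset.add_sum_erase (a := i) Finset.univ (fun j => (if i < j ∧ _ then _ else (0 : R)) + _)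
      (Finset.mem_univ i)]
    simp only [lt_irrefl, false_and, if_false, add_zero, zero_add]
    refine Finset.sum_congr rfl fun j hj => ?_
    rcases lt_or_gt_of_ne (Finset.ne_of_mem_erase hj) with h | h
    · simp [h, not_lt.2 h.le]
    · simp [h, not_lt.2 h.le]
  rw [Finset.sum_congr rfl fun i _ => h2 i, Finset.sum_add_distrib, Finset.sum_add_distrib]
  have h3 : (∑ i, ∑ j, if j < i ∧ J = symmDiff (symmDiff I {i}) {j} then t i j else 0) =
      -∑ i, ∑ j, if i < j ∧ J = symmDiff (symmDiff I {i}) {j} then t i j else 0 := by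
    rw [Finset.sum_comm, ← Finset.sum_neg_distrib]
    refine Finset.sum_congr rfl fun i _ => ?_
    rw [← Finset.sum_neg_distrib]
    refine Finset.sum_congr rfl fun j _ => ?_
    rw [hsymm j i]
    by_cases h : i < j ∧ J = symmDiff (symmDiff I {i}) {j}
    · rw [if_pos h, if_pos h, hanti i j h.1, neg_neg]
    · rw [if_neg h, if_neg h, neg_zero]
  rw [h3, add_neg_cancel, add_zero, Matrix.smul_apply, Matrix.one_apply, smul_eq_mul, mul_ite,
    mul_one, mul_zero]
  split_ifs <;> simp

end Koszul

section Objects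

/-- The twist `E(k)[l] = (E ⊗ O(k)[l], d ⊗ Id)`. -/
def GMF.twist {W : S} (E : GMF W) (k l : ℤ) : GMF W where
  ι := E.ι
  deg i := E.deg i + (k, l)
  d := E.d
  d_homog a b := by rw [add_sub_add_right_eq_sub]; exact E.d_homog a b
  d_sq := E.d_sq

/-- The shift functor `E[n]` of the triangulated structure, `E[1] = (E ⊗ O[1], -d ⊗ Id)`. -/
noncomputable def GMF.shift {W : S} (E : GMF W) (n : ℤ) : GMF W where
  ι := E.ι
  deg i := E.deg i + (0, n)
  d := (n.negOnePow : ℤ) • E.d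
  d_homog a b := by
    rw [add_sub_add_right_eq_sub]
    exact zsmul_mem (K := weightedHomogeneousSubmodule ℂ wt _) (E.d_homog a b) _
  d_sq := by
    rw [Matrix.smul_mul, Matrix.mul_smul, smul_smul, E.d_sq, ← Units.val_mul, Int.units_mul_self,
      Units.val_one, one_smul]

/-- The direct sum of `m` copies of `E`. -/
noncomputable def GMF.power {W : S} (E : GMF W) (m : ℕ) : GMF W where
  ι := E.ι × Fin m
  deg i := E.deg i.1
  d := Matrix.blockDiagonal fun _ => E.d
  d_homog a b := by
    rw [Matrix.blockDiagonal_apply]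
    split_ifs
    · exact E.d_homog _ _
    · exact isWeightedHomogeneous_zero _ _ _
  d_sq := by
    rw [← Matrix.blockDiagonal_mul, E.d_sq, ← Matrix.blockDiagonal_one, ← Matrix.blockDiagonal_smul]
    rfl

/-- Morphisms of graded matrix factorizations over `X_±`: equivariant, of R-weight zero, and
intertwining the differentials. -/
structure GMF.Hom {W : S} (E F : GMF W) where
  mat : Matrix F.ι E.ι S
  homog : ∀ a b, BiHom (mat a b) (F.deg a - E.deg b)
  comm : mat * E.d = F.d * mat

/-- The cone of `f`, with underlying bundle `E[1] ⊕ F`. -/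
noncomputable def GMF.cone {W : S} {E F : GMF W} (f : GMF.Hom E F) : GMF W where
  ι := E.ι ⊕ F.ι
  deg := Sum.elim (fun i => E.deg i + (0, 1)) F.deg
  d := Matrix.fromBlocks (-E.d) 0 f.mat F.d
  d_homog a b := by
    rcases a with a | a <;> rcases b with b | b
    · simp only [Sum.elim_inl, add_sub_add_right_eq_sub]
      exact (weightedHomogeneousSubmodule ℂ wt _).neg_mem (E.d_homog a b)
    · exact isWeightedHomogeneous_zero _ _ _
    · have h := f.homog a b
      have e : F.deg a - (E.deg b + (0, 1)) + (0, 1) = F.deg a - E.deg b := by abel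
      simp only [Sum.elim_inl, Sum.elim_inr, e]
      exact h
    · exact F.d_homog a b
  d_sq := by
    rw [Matrix.fromBlocks_multiply, ← Matrix.fromBlocks_one, Matrix.fromBlocks_smul]
    simp [E.d_sq, F.d_sq, f.comm]

/-- The multiset of the `(k, l)` of all summands `O(k)[l]` of the underlying bundle. -/
def GMF.summands {W : S} (E : GMF W) : Multiset (ℤ × ℤ) := Finset.univ.val.map E.deg

/-- Polynomials in `x_1, …, x_6` as functions on `V`. -/
noncomputable def inclX : MvPolynomial (Fin 6) ℂ →ₐ[ℂ] S := rename Sum.inl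

noncomputable def x (i : Fin 6) : S := X (Sum.inl i)
noncomputable def p (j : Fin 2) : S := X (Sum.inr j)

/-- `W = p_1 W_1 + p_2 W_2`. -/
noncomputable def potential (w : Fin 2 → MvPolynomial (Fin 6) ℂ) : S := ∑ j, p j * inclX (w j)

theorem x_homog (i : Fin 6) : BiHom (x i) (1, 0) := isWeightedHomogeneous_X _ _ _
theorem p_homog (j : Fin 2) : BiHom (p j) (-3, 2) := isWeightedHomogeneous_X _ _ _

theorem inclX_homog {g : MvPolynomial (Fin 6) ℂ} {n : ℕ} (h : g.IsHomogeneous n) :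
    BiHom (inclX g) (n, 0) := by
  intro c hc
  obtain ⟨c', rfl, hc'⟩ := coeff_rename_ne_zero _ _ _ hc
  have h1 := h hc'
  rw [Finsupp.weight_apply, Finsupp.sum_mapDomain_index (by simp) (by intros; rw [add_smul])]
  rw [← h1, Finsupp.weight_apply, Finsupp.sum, Finsupp.sum]
  ext
  · simp [Prod.fst_sum, wt]
  · simp [Prod.snd_sum, wt]

theorem koszul_homog {r : ℕ} {a b : Fin r → S} {k : ℤ × ℤ}
    (ha : ∀ i, BiHom (a i) (k + (0, 1))) (hb : ∀ i, BiHom (b i) (-k + (0, 1)))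
    (J I : Finset (Fin r)) :
    BiHom (koszul a b J I) ((J.card : ℤ) • k - (I.card : ℤ) • k + (0, 1)) := by
  refine IsWeightedHomogeneous.sum _ _ _ fun i _ => ?_
  split_ifs with h hi
  · have hc : (J.card : ℤ) = I.card - 1 := by
      have : J = I.erase i := by
        rw [h]; ext k; simp only [Finset.mem_symmDiff, Finset.mem_singleton, Finset.mem_erase]
        by_cases hk : k = i
        · subst hk; simp [hi]
        · simp [hk]
      rw [this, Finset.cast_card_erase_of_mem hi]
    have e : (J.card : ℤ) • k - (I.card : ℤ) • k + (0, 1) = -k + (0, 1) := by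
      rw [hc, sub_smul, one_smul]; abel
    rw [e]
    rcases neg_one_pow_eq_or S (pos i I) with h' | h' <;> rw [h']
    · simpa using hb i
    · rw [neg_one_mul]; exact (weightedHomogeneousSubmodule ℂ wt _).neg_mem (hb i)
  · have hc : (J.card : ℤ) = I.card + 1 := by
      have : J = insert i I := by
        rw [h]; ext k; simp only [Finset.mem_symmDiff, Finset.mem_singleton, Finset.mem_insert]
        by_cases hk : k = i
        · subst hk; simp [hi]
        · simp [hk]
      rw [this, Finset.card_insert_of_notMem hi]; push_cast; rfl
    have e : (J.card : ℤ) • k - (I.card : ℤ) • k + (0, 1) = k + (0, 1) := by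
      rw [hc, add_smul, one_smul]; abel
    rw [e]
    rcases neg_one_pow_eq_or S (pos i I) with h' | h' <;> rw [h']
    · simpa using ha i
    · rw [neg_one_mul]; exact (weightedHomogeneousSubmodule ℂ wt _).neg_mem (ha i)
  · exact isWeightedHomogeneous_zero _ _ _

/-- `K_+`: the bundle is the exterior algebra of `O(-3)[1]^2`, the differential is
`s_p ∧ (-) + s_W ∨ (-)`. -/
noncomputable def kPlus (w : Fin 2 → MvPolynomial (Fin 6) ℂ) (hw : ∀ j, (w j).IsHomogeneous 3) :
    GMF (potential w) where
  ι := Finset (Fin 2)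
  deg I := (I.card : ℤ) • ((-3, 1) : ℤ × ℤ)
  d := koszul p fun j => inclX (w j)
  d_homog := koszul_homog (fun j => p_homog j) fun j => inclX_homog (hw j)
  d_sq := koszul_sq _ _

/-- `K_-`: the bundle is the exterior algebra of `O(1)[-1]^6`, the differential is
`s_x ∧ (-) + s_pf ∨ (-)`, where the components of `s_pf` are `p_1 f_{1i} + p_2 f_{2i}`. -/
noncomputable def kMinus (w : Fin 2 → MvPolynomial (Fin 6) ℂ)
    (f : Fin 2 → Fin 6 → MvPolynomial (Fin 6) ℂ) (hf : ∀ j i, (f j i).IsHomogeneous 2)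
    (hwf : ∀ j, w j = ∑ i, X i * f j i) : GMF (potential w) where
  ι := Finset (Fin 6)
  deg I := (I.card : ℤ) • ((1, -1) : ℤ × ℤ)
  d := koszul x fun i => ∑ j, p j * inclX (f j i)
  d_homog := koszul_homog (fun i => x_homog i) fun i =>
    IsWeightedHomogeneous.sum _ _ _ fun j _ => (p_homog j).mul (inclX_homog (hf j i))
  d_sq := by
    rw [koszul_sq]
    congr 1
    simp only [potential, hwf, map_sum, map_mul, Finset.mul_sum]
    rw [Finset.sum_comm]
    refine Finset.sum_congr rfl fun j _ => Finset.sum_congr rfl fun i _ => ?_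
    rw [show inclX (X i) = x i from rename_X _ _]
    ring

end Objects

end LGCY

/-! The argument moves a factorization out of the lowest weight of its window, one R-weight at a
time. Suppose that all summands `O(k)[l]` of `E` have `k ≥ t`, and let `n` be the largest `l` among
the summands `O(t)[l]`. A component of `d` from `O(k)[l]` to `O(t)[n]` has bidegree `(t - k, n - l +
1)`. A monomial in the `x_i` alone has `ℂ^*`-weight `≥ 0` and R-weight `0`, so it can occur there
only if `k = t` and `l = n + 1`, which the choice of `n` rules out. Hence every component into
`O(t)[n]^m` lies in the ideal `(p_1, p_2)`, and the projection `E → O(t)[n]^m` is closed modulo this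
ideal.

The top exterior power of `K_+(t + 6)[n - 2]` is `O(t)[n]`, and `K_+` is the Koszul factorization of
the locus `p_1 = p_2 = 0`. Because `p_1, p_2` is a regular sequence, the projection therefore lifts
to a morphism `g` from `E` to `m` copies of `K_+(t + 6)[n - 2]` (`exists_hom_kPlus`). In
`cone(g)[-1]` the block between the two copies of `O(t)[n]^m` is `-1`, and Gaussian elimination
cancels them (`exists_gaussian_elimination`). The rest of `K_+`, shifted by `-1`, supplies `O(t +
6)[n - 3]^m` and `O(t + 3)[n - 2]^{2m}`. The homotopy equivalence is polynomial, so it holds over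
`X_+` and `X_-` alike (`exists_isStep`).

Over `X_-` the factorization `K_+` is contractible: where `p_i ≠ 0`, contraction with `p_i⁻¹` in the
`i`-th direction is a null-homotopy of the identity, and the two local ones glue in the Cech complex
(`exists_isContraction_kPlus`). So `cone(g)[-1]` is isomorphic to `E` there
(`nonempty_iso_shift_cone`).

A step creates no summand of weight `t` and none of weight above `t + 6`. Treating the R-weights of
the summands `O(t)[l]` in decreasing order thus turns the window `[t, t + 6]` into `[t + 1, t + 6]`
(`isStep_iterate_next`). The sequence starts with `K_-`, of window `[0, 6]`, at `t = 0`. -/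

namespace LGCY

/-! ### Polynomial morphisms as Cech cochains, and homotopy retracts -/

section Strict
variable {N : ℕ} {u : Fin N → Var} {W : S} {E F G : GMF W}

/-- `M` is a matrix of sections of R-weight `n` of the homomorphisms from `E` to `F`. -/
def IsHomog (E F : GMF W) (n : ℤ) (M : Matrix F.ι E.ι S) : Prop :=
  ∀ a b, BiHom (M a b) (F.deg a - E.deg b + (0, n))

theorem IsHomog.add {n : ℤ} {M M' : Matrix F.ι E.ι S} (h : IsHomog E F n M)
    (h' : IsHomog E F n M') : IsHomog E F n (M + M') := fun a b => (h a b).add (h' a b)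

theorem IsHomog.neg {n : ℤ} {M : Matrix F.ι E.ι S} (h : IsHomog E F n M) :
    IsHomog E F n (-M) :=
  fun a b => (weightedHomogeneousSubmodule ℂ wt _).neg_mem (h a b)

theorem IsHomog.sub {n : ℤ} {M M' : Matrix F.ι E.ι S} (h : IsHomog E F n M)
    (h' : IsHomog E F n M') : IsHomog E F n (M - M') := by
  rw [sub_eq_add_neg]; exact h.add h'.neg

theorem IsHomog.mul {n m : ℤ} {M : Matrix F.ι E.ι S} {M' : Matrix G.ι F.ι S}
    (h' : IsHomog F G n M') (h : IsHomog E F m M) : IsHomog E G (n + m) (M' * M) := by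
  intro a c
  rw [Matrix.mul_apply]
  refine IsWeightedHomogeneous.sum _ _ _ fun b _ => ?_
  convert (h' a b).mul (h b c) using 1
  ext <;> simp only [Prod.fst_add, Prod.fst_sub, Prod.snd_add, Prod.snd_sub] <;> ring

theorem IsHomog.one : IsHomog E E 0 1 := by
  intro a b
  rw [Matrix.one_apply]
  split_ifs with h
  · subst h
    have h0 : E.deg a - E.deg a + (0, 0) = 0 := by simp
    rw [h0]
    exact isWeightedHomogeneous_one ℂ wt
  · exact isWeightedHomogeneous_zero _ _ _

/-- The cochain which takes the value `M` on each chart. -/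
noncomputable def strict (N : ℕ) (E F : GMF W) (M : Matrix F.ι E.ι S) : PreHom N E F :=
  fun I => if I.card = 1 then M.map (algebraMap S K) else 0

theorem strict_eq_mul_one (M : Matrix F.ι E.ι S) (I : Finset (Fin N)) :
    strict N E F M I = M.map (algebraMap S K) * one N E I := by
  rw [strict, one]; split_ifs <;> simp

theorem strict_eq_one_mul (M : Matrix F.ι E.ι S) (I : Finset (Fin N)) :
    strict N E F M I = one N F I * M.map (algebraMap S K) := by
  rw [strict, one]; split_ifs <;> simp

theorem strict_one : strict N E E 1 = one N E := by
  funext I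
  rw [strict_eq_mul_one, Matrix.map_one _ (map_zero _) (map_one _), Matrix.one_mul]

theorem strict_add (M M' : Matrix F.ι E.ι S) :
    strict N E F (M + M') = strict N E F M + strict N E F M' := by
  funext I
  simp only [strict, Pi.add_apply]
  split_ifs
  · exact Matrix.map_add _ (map_add _) _ _
  · simp

theorem strict_neg (M : Matrix F.ι E.ι S) : strict N E F (-M) = -strict N E F M := by
  rw [eq_neg_iff_add_eq_zero, ← strict_add, neg_add_cancel]
  funext I
  simp [strict]

theorem strict_sub (M M' : Matrix F.ι E.ι S) :
    strict N E F (M - M') = strict N E F M - strict N E F M' := by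
  rw [sub_eq_add_neg, strict_add, strict_neg, sub_eq_add_neg]

theorem strict_zero : strict N E F 0 = 0 := by
  simpa using strict_sub (N := N) (E := E) (F := F) 0 0

/-- A constant cochain is a matrix times `one`, and `one` is a unit for the cup product, so no
splitting of the index set survives. -/
theorem cup_strict (φ : PreHom N F G) (hφ : φ ∅ = 0) (M : Matrix F.ι E.ι S) :
    cup φ (strict N E F M) = fun I => φ I * M.map (algebraMap S K) := by
  funext I
  conv_rhs => rw [← cup_one hφ]
  simp only [cup, strict_eq_one_mul, Matrix.sum_mul, Matrix.mul_assoc]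

theorem strict_cup (φ : PreHom N E F) (hφ : φ ∅ = 0) (M : Matrix G.ι F.ι S) :
    cup (strict N F G M) φ = fun I => M.map (algebraMap S K) * φ I := by
  funext I
  conv_rhs => rw [← one_cup hφ]
  simp only [cup, strict_eq_mul_one, Matrix.mul_sum, Matrix.mul_assoc]

theorem strict_empty (M : Matrix F.ι E.ι S) : strict N E F M ∅ = 0 := by simp [strict]

theorem strict_mul (M' : Matrix G.ι F.ι S) (M : Matrix F.ι E.ι S) :
    strict N E G (M' * M) = cup (strict N F G M') (strict N E F M) := by
  rw [strict_cup _ (strict_empty M)]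
  funext I
  simp only [strict_eq_mul_one, Matrix.map_mul, Matrix.mul_assoc]

theorem IsHomog.isCochain {n : ℤ} {M : Matrix F.ι E.ι S} (h : IsHomog E F n M) :
    IsCochain u n (strict N E F M) := by
  refine ⟨strict_empty M, fun I _ a b => ?_⟩
  rw [strict]
  split_ifs with hI
  · refine isSection_algebraMap u I ?_
    simpa [hI] using h a b
  · exact isSection_zero u I _

theorem delta_strict (M : Matrix F.ι E.ι S) : delta (strict N E F M) = 0 := by
  funext I
  have h : delta (one N E) I = 0 := by rw [delta_one]; rfl
  rw [delta] at h ⊢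
  simp only [strict_eq_mul_one, ← Matrix.mul_smul]
  rw [← Matrix.mul_sum, h, Matrix.mul_zero, Pi.zero_apply]

theorem D_strict_zero (M : Matrix F.ι E.ι S) :
    D 0 (strict N E F M) = strict N E F (F.d * M - M * E.d) := by
  funext I
  rw [D, delta_strict, strict_sub]
  simp only [Pi.zero_apply, Pi.sub_apply, strict, Matrix.mul_zero, zero_add, zpow_zero, one_smul, dK]
  split_ifs <;> simp

theorem D_strict_neg_one (M : Matrix F.ι E.ι S) :
    D (-1) (strict N E F M) = strict N E F (F.d * M + M * E.d) := by
  funext I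
  rw [D, delta_strict, strict_add]
  simp only [Pi.zero_apply, Pi.add_apply, strict, Matrix.mul_zero, zero_add, dK, zpow_neg_one,
    inv_neg_one, neg_one_smul, sub_neg_eq_add]
  split_ifs <;> simp

theorem nonempty_iso_of_cocycles (φ : Cocycle u E F) (ψ : Cocycle u F E)
    (h₁ : ∃ h : PreHom N E E, IsCochain u (-1) h ∧ cup ψ.1 φ.1 - one N E = D (-1) h)
    (h₂ : ∃ h : PreHom N F F, IsCochain u (-1) h ∧ cup φ.1 ψ.1 - one N F = D (-1) h) :
    Nonempty ((DMF.of E : DMF u W) ≅ DMF.of F) :=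
  ⟨{ hom := Quotient.mk (homotopic u E F) φ
     inv := Quotient.mk (homotopic u F E) ψ
     hom_inv_id := Quotient.sound (s := homotopic u E E) h₁
     inv_hom_id := Quotient.sound (s := homotopic u F F) h₂ }⟩

/-- The maps and the homotopy are polynomial, hence global sections on every chart. The conclusion
therefore holds for any cover `u`, in particular for `X_+` and `X_-` simultaneously. -/
theorem nonempty_iso_of_retract {f : Matrix F.ι E.ι S} {g : Matrix E.ι F.ι S}
    {h : Matrix F.ι F.ι S} (hf : IsHomog E F 0 f) (hg : IsHomog F E 0 g) (hh : IsHomog F F (-1) h)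
    (fd : f * E.d = F.d * f) (gd : g * F.d = E.d * g) (gf : g * f = 1)
    (fg : 1 - f * g = F.d * h + h * F.d) :
    Nonempty ((DMF.of E : DMF u W) ≅ DMF.of F) := by
  refine nonempty_iso_of_cocycles
    ⟨strict N E F f, hf.isCochain, by rw [D_strict_zero, fd, sub_self, strict_zero]⟩
    ⟨strict N F E g, hg.isCochain, by rw [D_strict_zero, gd, sub_self, strict_zero]⟩
    ⟨0, .zero, ?_⟩ ⟨strict N F F (-h), hh.neg.isCochain, ?_⟩
  · rw [← strict_mul, gf, strict_one, sub_self, D_zero]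
  · rw [D_strict_neg_one, ← strict_mul, ← strict_one, ← strict_sub, Matrix.mul_neg, Matrix.neg_mul,
      ← neg_add, ← fg, neg_sub]

/-- A homotopy retract of a graded matrix factorization is a graded matrix factorization. -/
noncomputable def GMF.retract (C : GMF W) {α : Type} [Fintype α] [DecidableEq α] (deg : α → ℤ × ℤ)
    (f : Matrix C.ι α S) (g : Matrix α C.ι S) (h : Matrix C.ι C.ι S)
    (hf : ∀ a b, BiHom (f a b) (C.deg a - deg b)) (hg : ∀ a b, BiHom (g a b) (deg a - C.deg b))
    (gf : g * f = 1) (fg : 1 - f * g = C.d * h + h * C.d) : GMF W where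
  ι := α
  deg := deg
  d := g * C.d * f
  d_homog a b := by
    rw [Matrix.mul_apply]
    refine IsWeightedHomogeneous.sum _ _ _ fun c _ => ?_
    rw [Matrix.mul_apply, Finset.sum_mul]
    refine IsWeightedHomogeneous.sum _ _ _ fun c' _ => ?_
    convert ((hg a c').mul (C.d_homog c' c)).mul (hf c b) using 1
    abel
  d_sq := by
    have e : f * g = 1 - (C.d * h + h * C.d) := by rw [← fg, sub_sub_cancel]
    -- The graded commutator of `d` with `h` commutes with `d`, because `d²` is the scalar `W`. With
    -- this and `g f = 1`, the square of `g d f` reduces to `g d² f`.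
    have e' : f * g * C.d = C.d * (f * g) := by
      rw [e, Matrix.sub_mul, Matrix.mul_sub, Matrix.add_mul, Matrix.mul_add, ← Matrix.mul_assoc C.d,
        Matrix.mul_assoc h, C.d_sq, Matrix.mul_assoc C.d h]
      simp only [Matrix.mul_smul, Matrix.smul_mul, Matrix.mul_one, Matrix.one_mul]
      abel
    calc g * C.d * f * (g * C.d * f) = g * C.d * (f * g * C.d) * f := by
          simp only [Matrix.mul_assoc]
      _ = g * (C.d * C.d) * f * (g * f) := by rw [e']; simp only [Matrix.mul_assoc]
      _ = W • 1 := by rw [C.d_sq]; simp [gf]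

theorem nonempty_retract_iso (C : GMF W) {α : Type} [Fintype α] [DecidableEq α] (deg : α → ℤ × ℤ)
    (f : Matrix C.ι α S) (g : Matrix α C.ι S) (h : Matrix C.ι C.ι S)
    (hf : ∀ a b, BiHom (f a b) (C.deg a - deg b)) (hg : ∀ a b, BiHom (g a b) (deg a - C.deg b))
    (hh : IsHomog C C (-1) h)
    (gf : g * f = 1) (fg : 1 - f * g = C.d * h + h * C.d) :
    Nonempty ((DMF.of (C.retract deg f g h hf hg gf fg) : DMF u W) ≅ DMF.of C) := by
  have e : f * g = 1 - (C.d * h + h * C.d) := by rw [← fg, sub_sub_cancel]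
  have e' : f * g * C.d = C.d * (f * g) := by
    rw [e, Matrix.sub_mul, Matrix.mul_sub, Matrix.add_mul, Matrix.mul_add, ← Matrix.mul_assoc C.d,
      Matrix.mul_assoc h, C.d_sq, Matrix.mul_assoc C.d h]
    simp only [Matrix.mul_smul, Matrix.smul_mul, Matrix.mul_one, Matrix.one_mul]
    abel
  refine nonempty_iso_of_retract (E := C.retract deg f g h hf hg gf fg) (f := f) (g := g) (h := h)
    (fun a b => ?_) (fun a b => ?_) hh ?_ ?_ gf fg
  · convert hf a b using 1; exact add_zero _
  · convert hg a b using 1; exact add_zero _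
  · change f * (g * C.d * f) = _
    rw [← Matrix.mul_assoc, ← Matrix.mul_assoc, e', Matrix.mul_assoc, Matrix.mul_assoc f, gf,
      Matrix.mul_one]
    rfl
  · change _ = g * C.d * f * g
    rw [Matrix.mul_assoc (g * C.d), Matrix.mul_assoc g, ← e', ← Matrix.mul_assoc,
      ← Matrix.mul_assoc, gf, Matrix.one_mul]
    rfl

end Strict

/-! ### Gaussian elimination of an invertible block of the differential -/

section Elimination
variable {W : S}

/-- The block of `d` from the summands `b` to the summands `b'` is invertible, and its inverse,
extended by zero, is a homotopy `h` with `h² = 0` and `h d h = h`. Then `1 - (d h + h d)` is an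
idempotent whose image is a copy of the remaining summands `i`. The degree condition says that `h`
has R-weight `-1`. -/
theorem exists_gaussian_elimination (C : GMF W) {α β : Type} [Fintype α] [DecidableEq α]
    [Fintype β] [DecidableEq β] (i : α → C.ι) (b b' : β → C.ι)
    (hi : Function.Bijective (Sum.elim i (Sum.elim b b')))
    (hd : ∀ j k, C.d (b' j) (b k) = if j = k then -1 else 0)
    (hdeg : ∀ j, C.deg (b j) - C.deg (b' j) + (0, -1) = 0) :
    ∃ E : GMF W, E.summands = Finset.univ.val.map (fun a => C.deg (i a)) ∧
      ∀ (N : ℕ) (u : Fin N → Var), Nonempty ((DMF.of E : DMF u W) ≅ DMF.of C) := by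
  let I : Matrix C.ι C.ι S := 1
  let sel {γ : Type} (φ : γ → C.ι) : Matrix C.ι γ S := I.submatrix id φ
  let row {γ : Type} (φ : γ → C.ι) : Matrix γ C.ι S := I.submatrix φ id
  have mul_sel : ∀ {γ δ : Type} [Fintype δ] (M : Matrix γ C.ι S) (φ : δ → C.ι),
      M * sel φ = M.submatrix id φ := by
    intro γ δ _ M φ
    ext a c
    simp [sel, I, Matrix.mul_apply, Matrix.one_apply]
  have row_mul : ∀ {γ δ : Type} [Fintype δ] (M : Matrix C.ι γ S) (φ : δ → C.ι),
      row φ * M = M.submatrix φ id := by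
    intro γ δ _ M φ
    ext a c
    simp [row, I, Matrix.mul_apply, Matrix.one_apply]
  have hib : ∀ j k, i j ≠ b k := fun j k h => by
    simpa using @hi.1 (.inl j) (.inr (.inl k)) h
  have hib' : ∀ j k, i j ≠ b' k := fun j k h => by
    simpa using @hi.1 (.inl j) (.inr (.inr k)) h
  have hbb' : ∀ j k, b j ≠ b' k := fun j k h => by
    simpa using @hi.1 (.inr (.inl j)) (.inr (.inr k)) h
  have hii : Function.Injective i := fun j k h => by
    simpa using @hi.1 (.inl j) (.inl k) h
  have hbb : Function.Injective b := fun j k h => by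
    simpa using @hi.1 (.inr (.inl j)) (.inr (.inl k)) h
  have hb'b' : Function.Injective b' := fun j k h => by
    simpa using @hi.1 (.inr (.inr j)) (.inr (.inr k)) h
  have r_i_i : row i * sel i = 1 := by
    rw [mul_sel]
    exact Matrix.submatrix_one _ hii
  have r_b'_b' : row b' * sel b' = 1 := by
    rw [mul_sel]
    exact Matrix.submatrix_one _ hb'b'
  have r_b_b : row b * sel b = 1 := by
    rw [mul_sel]
    exact Matrix.submatrix_one _ hbb
  have r_i_b : row i * sel b = 0 := by
    rw [mul_sel]
    exact Matrix.ext fun j k => Matrix.one_apply_ne (hib j k)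
  have r_b'_i : row b' * sel i = 0 := by
    rw [mul_sel]
    exact Matrix.ext fun j k => Matrix.one_apply_ne (hib' k j).symm
  have r_b'_b : row b' * sel b = 0 := by
    rw [mul_sel]
    exact Matrix.ext fun j k => Matrix.one_apply_ne (hbb' k j).symm
  have r_d : row b' * (C.d * sel b) = -1 := by
    rw [mul_sel, row_mul]
    refine Matrix.ext fun j k => ?_
    simp only [Matrix.submatrix_apply, hd, Matrix.neg_apply, Matrix.one_apply, id]
    split_ifs <;> simp
  have total : sel i * row i + (sel b * row b + sel b' * row b') = 1 := by
    ext x y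
    have : (1 : Matrix C.ι C.ι S) x y = ∑ z, I x z * I z y := by
      rw [← Matrix.mul_apply, Matrix.one_mul]
    rw [this, ← hi.sum_comp, Fintype.sum_sum_type, Fintype.sum_sum_type]
    rfl
  -- The block of `d` is `-1`, so its inverse carries the same sign.
  let h : Matrix C.ι C.ι S := -(sel b * row b')
  have hsel_i : h * sel i = 0 := by
    rw [Matrix.neg_mul, Matrix.mul_assoc, r_b'_i, Matrix.mul_zero, neg_zero]
  have hsel_b' : h * sel b' = -sel b := by
    rw [Matrix.neg_mul, Matrix.mul_assoc, r_b'_b', Matrix.mul_one]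
  have row_h : row i * h = 0 := by
    rw [Matrix.mul_neg, ← Matrix.mul_assoc, r_i_b, Matrix.zero_mul, neg_zero]
  have h_h : h * h = 0 := by
    rw [Matrix.neg_mul, Matrix.mul_neg, neg_neg, Matrix.mul_assoc, ← Matrix.mul_assoc (row b'), r_b'_b,
      Matrix.zero_mul, Matrix.mul_zero]
  have hdh : h * (C.d * h) = h := by
    simp only [h, Matrix.mul_neg, Matrix.neg_mul, neg_neg]
    rw [Matrix.mul_assoc, ← Matrix.mul_assoc C.d, ← Matrix.mul_assoc (row b'), r_d,
      Matrix.neg_mul, Matrix.one_mul, Matrix.mul_neg]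
  obtain ⟨P, P_def⟩ : ∃ P : Matrix C.ι C.ι S, P = 1 - (C.d * h + h * C.d) := ⟨_, rfl⟩
  have Ph : P * h = 0 := by
    rw [P_def, Matrix.sub_mul, Matrix.add_mul, Matrix.mul_assoc, h_h, Matrix.mul_assoc, hdh]
    simp
  have hP : h * P = 0 := by
    rw [P_def, Matrix.mul_sub, Matrix.mul_add, ← Matrix.mul_assoc h h, h_h, hdh]
    simp
  have PP : P * P = P := by
    have : P * (C.d * h) = 0 := by
      rw [P_def, Matrix.sub_mul, Matrix.add_mul, Matrix.mul_assoc C.d h, hdh, Matrix.mul_assoc h,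
        ← Matrix.mul_assoc C.d C.d, C.d_sq, Matrix.smul_mul, Matrix.one_mul, Matrix.mul_smul,
        Matrix.one_mul, h_h]
      simp
    nth_rewrite 2 [P_def]
    rw [Matrix.mul_sub, Matrix.mul_add, this, ← Matrix.mul_assoc, Ph]
    simp
  have hom_h : IsHomog C C (-1) h := by
    intro x y
    simp only [h, Matrix.neg_apply, Matrix.mul_apply]
    refine (weightedHomogeneousSubmodule ℂ wt _).neg_mem
      (IsWeightedHomogeneous.sum _ _ _ fun j _ => ?_)
    simp only [sel, row, I, Matrix.submatrix_apply, Matrix.one_apply, id]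
    split_ifs with h1 h2
    · rw [h1, ← h2, hdeg, one_mul]
      exact isWeightedHomogeneous_one ℂ wt
    all_goals simpa using isWeightedHomogeneous_zero ℂ wt _
  have hom_P : IsHomog C C 0 P := by
    have hd : IsHomog C C 1 C.d := C.d_homog
    rw [P_def]
    exact IsHomog.one.sub ((hd.mul hom_h).add (hom_h.mul hd))
  -- The correction terms in `P` drop out since `h` vanishes on the summands `i` and has no
  -- component into them.
  have gf : row i * P * (P * sel i) = 1 := by
    rw [Matrix.mul_assoc, ← Matrix.mul_assoc P, PP]
    rw [P_def, Matrix.sub_mul, Matrix.add_mul, Matrix.mul_assoc C.d, hsel_i, Matrix.mul_sub,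
      Matrix.mul_add, Matrix.mul_assoc h, ← Matrix.mul_assoc (row i) h, row_h, Matrix.one_mul, r_i_i]
    simp
  -- The summands `b` lie in the image of `h` and the coordinates on `b'` factor through `h`. As `P
  -- h = h P = 0`, both are killed by `P`, so inserting the projection onto `i` between two copies
  -- of `P` changes nothing.
  have fg : 1 - P * sel i * (row i * P) = C.d * h + h * C.d := by
    have h1 : sel i * row i = 1 - (sel b * row b + sel b' * row b') := by
      rw [← total, add_sub_cancel_right]
    have h2 : P * sel b = 0 := by
      rw [← neg_neg (sel b), ← hsel_b', Matrix.mul_neg, ← Matrix.mul_assoc, Ph, Matrix.zero_mul,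
        neg_zero]
    have h3 : row b' * P = 0 := by
      have : row b' = -(row b * h) := by
        rw [Matrix.mul_neg, neg_neg, ← Matrix.mul_assoc, r_b_b, Matrix.one_mul]
      rw [this, Matrix.neg_mul, Matrix.mul_assoc, hP, Matrix.mul_zero, neg_zero]
    rw [Matrix.mul_assoc, ← Matrix.mul_assoc (sel i), h1, Matrix.sub_mul, Matrix.mul_sub,
      Matrix.add_mul, Matrix.mul_add, Matrix.one_mul, PP, ← Matrix.mul_assoc P,
      ← Matrix.mul_assoc P, h2, Matrix.mul_assoc (sel b'), h3]
    simp [P_def]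
  refine ⟨C.retract (fun a => C.deg (i a)) (P * sel i) (row i * P) h (fun x y => ?_)
    (fun x y => ?_) gf fg, rfl, fun N u => nonempty_retract_iso C _ _ _ h _ _ hom_h gf fg⟩
  · rw [mul_sel]
    exact (congrArg (BiHom _) (add_zero _)).mp (hom_P x (i y))
  · rw [row_mul]
    exact (congrArg (BiHom _) (add_zero _)).mp (hom_P (i x) y)

end Elimination

/-! ### Extensions by a contractible factorization -/

section Contraction
variable {N : ℕ} {u : Fin N → Var} {W : S} {E F C : GMF W}

/-- A null-homotopy of the identity of `F`. -/
structure IsContraction (u : Fin N → Var) (F : GMF W) (H : PreHom N F F) : Prop where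
  isCochain : IsCochain u (-1) H
  D_eq : D (-1) H = one N F

theorem D_strict_one (M : Matrix F.ι E.ι S) :
    D 1 (strict N E F M) = strict N E F (F.d * M + M * E.d) := by
  rw [← D_strict_neg_one]
  funext I
  simp only [D, zpow_neg_one, zpow_one, inv_neg_one]

/-- Here `C` is an extension of `E` by `F`, split on underlying bundles, with extension class `γ`.
The section `s` fails to be closed by `j γ`. If `D H = 1` on `F`, then `D (H γ) = γ`, so `s - j H γ`
is closed and inverts `π` up to homotopy. Only `H` is a genuine Cech cochain; all other data are
polynomial. -/
theorem nonempty_iso_of_contractible_subobject {j : Matrix C.ι F.ι S} {q : Matrix F.ι C.ι S}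
    {s : Matrix C.ι E.ι S} {π : Matrix E.ι C.ι S} {γ : Matrix F.ι E.ι S}
    (hj : IsHomog F C 0 j) (hq : IsHomog C F 0 q) (hs : IsHomog E C 0 s) (hπ : IsHomog C E 0 π)
    (hγ : IsHomog E F 1 γ) (πs : π * s = 1) (πj : π * j = 0) (tot : s * π + j * q = 1)
    (ds : C.d * s - s * E.d = j * γ) (dγ : F.d * γ + γ * E.d = 0) (dj : C.d * j - j * F.d = 0)
    (dπ : E.d * π - π * C.d = 0) (dq : F.d * q - q * C.d = -(γ * π))
    {H : PreHom N F F} (hH : IsContraction u F H) :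
    Nonempty ((DMF.of E : DMF u W) ≅ DMF.of C) := by
  have cj : IsCochain u 0 (strict N F C j) := hj.isCochain
  have cq : IsCochain u 0 (strict N C F q) := hq.isCochain
  have cs : IsCochain u 0 (strict N E C s) := hs.isCochain
  have cπ : IsCochain u 0 (strict N C E π) := hπ.isCochain
  have cγ : IsCochain u 1 (strict N E F γ) := hγ.isCochain
  have cHγ : IsCochain u 0 (cup H (strict N E F γ)) := hH.isCochain.cup cγ
  have cHq : IsCochain u (-1) (cup H (strict N C F q)) := hH.isCochain.cup cq
  have cjHγ : IsCochain u 0 (cup (strict N F C j) (cup H (strict N E F γ))) := cj.cup cHγ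
  have cjHq : IsCochain u (-1) (cup (strict N F C j) (cup H (strict N C F q))) := cj.cup cHq
  have DHγ : D 0 (cup H (strict N E F γ)) = strict N E F γ := by
    have h : D 0 (cup H (strict N E F γ)) = _ := D_cup hH.isCochain cγ
    rw [h, hH.D_eq, D_strict_one, dγ, strict_zero, cup_zero, smul_zero, add_zero,
      one_cup (strict_empty γ)]
  have DjHγ : D 0 (cup (strict N F C j) (cup H (strict N E F γ))) = strict N E C (j * γ) := by
    have h : D 0 (cup (strict N F C j) (cup H (strict N E F γ))) = _ := D_cup cj cHγ
    rw [h, D_strict_zero, dj, strict_zero, zero_cup, DHγ, zpow_zero, one_smul, zero_add, strict_mul]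
  -- The Leibniz rule gives `q - H (D q)`, and `D q = -γ π`.
  have DHq : D (-1) (cup H (strict N C F q)) =
      strict N C F q + cup H (strict N C F (γ * π)) := by
    have h : D (-1) (cup H (strict N C F q)) = _ := D_cup hH.isCochain cq
    rw [h, hH.D_eq, D_strict_zero, dq, one_cup (strict_empty q), zpow_neg_one, inv_neg_one,
      neg_one_smul, cup_strict _ hH.isCochain.empty, cup_strict _ hH.isCochain.empty]
    congr 1
    funext I
    simp only [Pi.neg_apply]
    rw [Matrix.map_neg _ (map_neg _), Matrix.mul_neg, neg_neg]
  have DjHq : D (-1) (cup (strict N F C j) (cup H (strict N C F q))) =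
      strict N C C (j * q) +
        cup (cup (strict N F C j) (cup H (strict N E F γ))) (strict N C E π) := by
    have h : D (-1) (cup (strict N F C j) (cup H (strict N C F q))) = _ := D_cup cj cHq
    rw [h, D_strict_zero, dj, strict_zero, zero_cup, DHq, zpow_zero, one_smul, zero_add, cup_add,
      strict_mul, strict_mul, cup_assoc, cup_assoc]
  have neg_cup : ∀ {E F G : GMF W} (ψ : PreHom N F G) (φ : PreHom N E F),
      cup (-ψ) φ = -cup ψ φ := fun ψ φ => by
    rw [eq_neg_iff_add_eq_zero, ← add_cup, neg_add_cancel, zero_cup]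
  have cup_neg : ∀ {E F G : GMF W} (ψ : PreHom N F G) (φ : PreHom N E F),
      cup ψ (-φ) = -cup ψ φ := fun ψ φ => by
    rw [eq_neg_iff_add_eq_zero, ← cup_add, neg_add_cancel, cup_zero]
  refine nonempty_iso_of_cocycles
    ⟨strict N E C s + -cup (strict N F C j) (cup H (strict N E F γ)), cs.add cjHγ.neg, ?_⟩
    ⟨strict N C E π, cπ, (D_strict_zero π).trans (by rw [dπ, strict_zero])⟩
    ⟨0, .zero, ?_⟩
    -- Since `s π - 1 = -j q`, the composite differs from the identity by `-(j q + j H γ π)`, which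
    -- is `-D (j H q)`.
    ⟨-cup (strict N F C j) (cup H (strict N C F q)), cjHq.neg, ?_⟩
  · rw [D_add, D_neg, DjHγ, D_strict_zero, ds, add_neg_cancel]
  · change cup _ (_ + _) - _ = _
    rw [D_zero, cup_add, cup_neg, ← cup_assoc, ← strict_mul, ← strict_mul, πs, πj, strict_zero,
      zero_cup, strict_one, neg_zero, add_zero, sub_self]
  · change cup (_ + _) _ - _ = _
    rw [D_neg, DjHq, add_cup, neg_cup, ← strict_mul, ← strict_one, ← tot, strict_add]
    abel

theorem nonempty_iso_shift_cone {E K : GMF W} (f : GMF.Hom E K) {H : PreHom N _ _}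
    (hH : IsContraction u (K.shift (-1)) H) :
    Nonempty ((DMF.of E : DMF u W) ≅ DMF.of ((GMF.cone f).shift (-1))) := by
  have hn : ((Int.negOnePow (-1) : ℤˣ) : ℤ) = -1 := rfl
  -- The shift cancels the sign on `E` and puts one on `f` and on `K`. Thus the shifted cone is the
  -- extension of `E` by `K[-1]` with class `-f`.
  have hC : ((GMF.cone f).shift (-1)).d = Matrix.fromBlocks E.d 0 (-f.mat) (-K.d) := by
    change ((Int.negOnePow (-1) : ℤˣ) : ℤ) • Matrix.fromBlocks (-E.d) 0 f.mat K.d = _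
    rw [hn, neg_one_smul, Matrix.fromBlocks_neg, neg_neg, neg_zero]
  have hF : (K.shift (-1)).d = -K.d := by
    change ((Int.negOnePow (-1) : ℤˣ) : ℤ) • K.d = _
    rw [hn, neg_one_smul]
  let j : Matrix (E.ι ⊕ K.ι) K.ι S := Matrix.fromRows 0 1
  let q : Matrix K.ι (E.ι ⊕ K.ι) S := Matrix.fromCols 0 1
  let s : Matrix (E.ι ⊕ K.ι) E.ι S := Matrix.fromRows 1 0
  let π : Matrix E.ι (E.ι ⊕ K.ι) S := Matrix.fromCols 1 0
  let d : Matrix (E.ι ⊕ K.ι) (E.ι ⊕ K.ι) S := Matrix.fromBlocks E.d 0 (-f.mat) (-K.d)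
  have πs : π * s = 1 := by simp [π, s, Matrix.fromCols_mul_fromRows]
  have πj : π * j = 0 := by simp [π, j, Matrix.fromCols_mul_fromRows]
  have tot : s * π + j * q = 1 := by
    rw [Matrix.fromRows_mul_fromCols, Matrix.fromRows_mul_fromCols, Matrix.fromBlocks_add]
    simp
  have ds : d * s - s * E.d = j * (-f.mat) := by
    ext (a | a) b : 2 <;>
    simp [d, s, j, Matrix.fromBlocks_mul_fromRows, Matrix.fromRows_mul]
  have dγ : -K.d * -f.mat + -f.mat * E.d = 0 := by
    rw [Matrix.neg_mul, Matrix.mul_neg, neg_neg, Matrix.neg_mul, f.comm, add_neg_cancel]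
  have dj : d * j - j * (-K.d) = 0 := by
    ext (a | a) b : 2 <;> simp [d, j, Matrix.fromBlocks_mul_fromRows, Matrix.fromRows_mul]
  have dπ : E.d * π - π * d = 0 := by
    ext a (b | b) : 2 <;> simp [d, π, Matrix.fromCols_mul_fromBlocks, Matrix.mul_fromCols]
  have dq : (-K.d) * q - q * d = -(-f.mat * π) := by
    ext a (b | b) : 2 <;> simp [d, q, π, Matrix.fromCols_mul_fromBlocks, Matrix.mul_fromCols]
  have h0 : ∀ (P : S) {k : ℤ × ℤ}, P = 0 → BiHom P k := fun P k h => by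
    rw [h]; exact isWeightedHomogeneous_zero _ _ _
  have h1 : ∀ {ι : Type} [DecidableEq ι] (a b : ι) (l : ℤ × ℤ), (a = b → l = 0) →
      BiHom ((1 : Matrix ι ι S) a b) l := fun a b l h => by
    rw [Matrix.one_apply]
    split_ifs with e
    · rw [h e]; exact isWeightedHomogeneous_one _ _
    · exact isWeightedHomogeneous_zero _ _ _
  have e1 : ∀ k : ℤ × ℤ, k - k + (0, 0) = 0 := fun k => by rw [sub_self]; rfl
  have e2 : ∀ k : ℤ × ℤ, k + (0, 1) + (0, -1) = k := fun k => by
    rw [add_assoc]; exact add_zero k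
  have e3 : ∀ k : ℤ × ℤ, k + (0, -1) + (0, 1) = k := fun k => by
    rw [add_assoc]; exact add_zero k
  refine nonempty_iso_of_contractible_subobject (E := E) (F := K.shift (-1))
    (C := (GMF.cone f).shift (-1)) (j := j) (q := q) (s := s) (π := π) (γ := -f.mat)
    ?_ ?_ ?_ ?_ ?_ πs πj tot ?_ ?_ ?_ ?_ ?_ hH
  · rintro (a | a) b
    · exact h0 _ rfl
    · exact h1 a b _ (by rintro rfl; exact e1 _)
  · rintro b (a | a)
    · exact h0 _ rfl
    · exact h1 b a _ (by rintro rfl; exact e1 _)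
  · rintro (a | a) b
    · exact h1 a b _ (by
        rintro rfl
        change E.deg a + (0, 1) + (0, -1) - E.deg a + (0, 0) = 0
        rw [e2, e1])
    · exact h0 _ rfl
  · rintro b (a | a)
    · exact h1 b a _ (by
        rintro rfl
        change E.deg b - (E.deg b + (0, 1) + (0, -1)) + (0, 0) = 0
        rw [e2, e1])
    · exact h0 _ rfl
  · intro a b
    refine (weightedHomogeneousSubmodule ℂ wt _).neg_mem ?_
    have h := f.homog a b
    rw [← e3 (K.deg a), add_sub_right_comm] at h
    exact h
  · rw [hC]; exact ds
  · rw [hF]; exact dγ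
  · rw [hC, hF]; exact dj
  · rw [hC]; exact dπ
  · rw [hC, hF]; exact dq

end Contraction

/-! ### Gluing contractions over two charts -/

section KPlus

/-- Contractions on two charts glue to a contraction over their union. -/
theorem exists_isContraction_of_charts {W : S} {u : Fin 2 → Var} {F : GMF W}
    (h : Fin 2 → Matrix F.ι F.ι K)
    (hs : ∀ i a b, IsSection u {i} (F.deg a - F.deg b + (0, -1)) (h i a b))
    (hd : ∀ i, dK F * h i + h i * dK F = 1) : ∃ H, IsContraction u F H := by
  -- On the overlap, `h 1 - h 0` anticommutes with `d` and `d (h 0) + (h 0) d = 1`. Hence `h 0 * (h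
  -- 1 - h 0)` has commutator `h 1 - h 0` with `d`. The factor `sgn F`, which anticommutes with `d`,
  -- matches the sign in front of the Cech differential in `D`.
  let H : PreHom 2 F F := fun I => if I = {0} then h 0 else if I = {1} then h 1 else
    if I = {0, 1} then sgn F * (h 0 * (h 1 - h 0)) else 0
  have H_empty : H ∅ = 0 := rfl
  have H0 : H {0} = h 0 := rfl
  have H1 : H {1} = h 1 := rfl
  have H01 : H {0, 1} = sgn F * (h 0 * (h 1 - h 0)) := rfl
  -- All coordinates have even R-weight, so `d`, of R-weight one, only links summands with `l` of
  -- opposite parity.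
  have d_sgn : dK F * sgn F = -(sgn F * dK F) := by
    have hd : IsHomog F F 1 F.d := F.d_homog
    have := (hd.isCochain (u := u)).sgn_mul (I := {0}) (Finset.singleton_nonempty 0)
    simp only [strict, Finset.card_singleton] at this
    rw [dK]
    simpa [neg_eq_iff_eq_neg] using (congrArg Neg.neg this).symm
  have cases : ∀ I : Finset (Fin 2), I = ∅ ∨ (∃ i, I = {i}) ∨ I = {0, 1} := by decide
  have H_singleton : ∀ i, H {i} = h i := by
    intro i; fin_cases i <;> rfl
  refine ⟨H, ⟨H_empty, ?_⟩, ?_⟩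
  · intro I hI a b
    rcases cases I with rfl | ⟨i, rfl⟩ | rfl
    · simp at hI
    · rw [H_singleton]
      simpa using hs i a b
    · have hs' : ∀ i a b, IsSection u {0, 1} (F.deg a - F.deg b + (0, -1)) (h i a b) :=
        fun i a b => (hs i a b).mono (by fin_cases i <;> simp)
      have key : IsSection u {0, 1} (F.deg a - F.deg b + (0, -2)) ((h 0 * (h 1 - h 0)) a b) := by
        rw [Matrix.mul_apply]
        refine IsSection.sum fun c _ => ?_
        have := (hs' 0 a c).mul ((hs' 1 c b).add (hs' 0 c b).neg)
        rw [Matrix.sub_apply, sub_eq_add_neg (h 1 c b)]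
        convert this using 1
        ext <;> simp only [Prod.fst_add, Prod.fst_sub, Prod.snd_add, Prod.snd_sub] <;> ring
      rw [H01, sgn, Matrix.diagonal_mul]
      have e : (-1 - ((({0, 1} : Finset (Fin 2)).card : ℤ) - 1)) = -2 := rfl
      rw [e]
      rcases Int.even_or_odd (F.deg a).2 with ha | ha
      · rw [ha.neg_one_zpow, one_mul]; exact key
      · rw [ha.neg_one_zpow, neg_one_mul]; exact key.neg
  · funext I
    simp only [D, zpow_neg_one, inv_neg_one, neg_one_smul, sub_neg_eq_add]
    rcases cases I with rfl | ⟨i, rfl⟩ | rfl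
    · simp [delta, H_empty, one]
    · simp [delta, H_empty, one, H_singleton, hd]
    · have e0 : ({0, 1} : Finset (Fin 2)).erase 0 = {1} := rfl
      have e1 : ({0, 1} : Finset (Fin 2)).erase 1 = {0} := rfl
      have p0 : pos (0 : Fin 2) {0, 1} = 0 := rfl
      have p1 : pos (1 : Fin 2) {0, 1} = 1 := rfl
      have ho : one 2 F {0, 1} = 0 := rfl
      rw [delta, Finset.sum_pair (by decide), e0, e1, p0, p1, H0, H1, H01, ho, pow_zero, one_smul,
        pow_one, neg_one_smul, ← sub_eq_add_neg, ← Matrix.mul_assoc (dK F), d_sgn, Matrix.neg_mul,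
        Matrix.mul_assoc (sgn F), Matrix.mul_assoc (sgn F), ← Matrix.mul_neg, ← Matrix.mul_add,
        ← Matrix.mul_add]
      have c : (h 1 - h 0) * dK F = -(dK F * (h 1 - h 0)) := by
        have := (hd 1).trans (hd 0).symm
        rw [Matrix.sub_mul, Matrix.mul_sub, eq_neg_iff_add_eq_zero]
        rw [sub_add_sub_comm, add_comm (h 1 * _), add_comm (h 0 * _), this, sub_self]
      rw [Matrix.mul_assoc (h 0), c, Matrix.mul_neg, ← Matrix.mul_assoc, ← Matrix.mul_assoc,
        ← sub_eq_add_neg, sub_eq_add_neg, add_assoc, ← neg_add, ← Matrix.add_mul, hd 0,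
        Matrix.one_mul, add_neg_cancel, Matrix.mul_zero]
end KPlus

/-! ### Contractibility of `K_+` over `X_-` -/

section KPlusContraction

section
variable {r : ℕ} {R : Type} [CommRing R]

theorem koszul_add (a b a' b' : Fin r → R) :
    koszul (a + a') (b + b') = koszul a b + koszul a' b' := by
  refine Matrix.ext fun J I => ?_
  simp only [koszul, Matrix.add_apply, ← Finset.sum_add_distrib, Pi.add_apply]
  refine Finset.sum_congr rfl fun i _ => ?_
  split_ifs <;> ring

/-- Polarization of `koszul_sq`. -/
theorem koszul_anticomm (a b a' b' : Fin r → R) :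
    koszul a b * koszul a' b' + koszul a' b' * koszul a b =
      (∑ i, (a i * b' i + a' i * b i)) • 1 := by
  have h := koszul_sq (a + a') (b + b')
  rw [koszul_add, Matrix.add_mul, Matrix.mul_add, Matrix.mul_add, koszul_sq, koszul_sq] at h
  have e : ∑ i, (a + a') i * (b + b') i =
      ∑ i, a i * b i + (∑ i, (a i * b' i + a' i * b i) + ∑ i, a' i * b' i) := by
    simp only [← Finset.sum_add_distrib, Pi.add_apply]
    exact Finset.sum_congr rfl fun i _ => by ring
  rw [e, add_smul, add_smul, add_assoc, add_right_inj, ← add_assoc, add_left_inj] at h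
  exact h

theorem koszul_map {R' : Type} [CommRing R'] (φ : R →+* R') (a b : Fin r → R) :
    (koszul a b).map φ = koszul (φ ∘ a) (φ ∘ b) := by
  refine Matrix.ext fun J I => ?_
  simp only [koszul, Matrix.map_apply, map_sum, apply_ite φ, map_mul, map_pow, map_neg, map_one,
    map_zero, Function.comp_apply]

theorem koszul_contraction_apply (i : Fin r) (c : R) (J I : Finset (Fin r)) :
    koszul 0 (Pi.single i c) J I =
      if i ∈ I ∧ J = I.erase i then (-1) ^ pos i I * c else 0 := by
  rw [koszul, Finset.sum_eq_single i]
  · by_cases hi : i ∈ I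
    · have : symmDiff I {i} = I.erase i := by
        ext k
        simp only [Finset.mem_symmDiff, Finset.mem_singleton, Finset.mem_erase]
        by_cases hk : k = i
        · subst hk; simp [hi]
        · simp [hk]
      simp [hi, this]
    · simp [hi]
  · intro k _ hk
    simp [Pi.single_eq_of_ne hk]
  · simp

end

/-- On `{p_i ≠ 0}` the contraction with the covector `p_i⁻¹` in position `i` has anticommutator `p_i
p_i⁻¹ = 1` with the Koszul differential. Twists and direct sums do not affect this. -/
theorem exists_isContraction_kPlus (w : Fin 2 → MvPolynomial (Fin 6) ℂ)
    (hw : ∀ j, (w j).IsHomogeneous 3) (k l : ℤ) (m : ℕ) :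
    ∃ H, IsContraction chartsMinus ((((kPlus w hw).twist k l).power m).shift (-1)) H := by
  have hp : ∀ i, algebraMap S K (p i) ≠ 0 := fun i => by
    rw [Ne, FaithfulSMul.algebraMap_eq_zero_iff]
    exact X_ne_zero _
  let c : Fin 2 → Matrix (Finset (Fin 2)) (Finset (Fin 2)) K := fun i =>
    koszul 0 (Pi.single i (algebraMap S K (p i))⁻¹)
  let d : Matrix (Finset (Fin 2)) (Finset (Fin 2)) S := koszul p fun j => inclX (w j)
  have hc : ∀ i, d.map (algebraMap S K) * c i + c i * d.map (algebraMap S K) = 1 := by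
    intro i
    simp only [c, d]
    rw [koszul_map, koszul_anticomm, Finset.sum_eq_single i]
    · simp [hp]
    · intro k _ hk
      simp [Pi.single_eq_of_ne hk]
    · simp
  -- The shift by `-1` negates the differential, so the homotopy is negated too.
  let h : Fin 2 → Matrix (Finset (Fin 2) × Fin m) (Finset (Fin 2) × Fin m) K := fun i =>
    -Matrix.blockDiagonal fun _ => c i
  let D : Matrix (Finset (Fin 2) × Fin m) (Finset (Fin 2) × Fin m) K :=
    -Matrix.blockDiagonal fun _ => d.map (algebraMap S K)
  have hD : D = ((-1 : ℤ) • Matrix.blockDiagonal (fun _ : Fin m => d)).map (algebraMap S K) := by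
    refine Matrix.ext fun a b => ?_
    simp only [D, Matrix.neg_apply, Matrix.map_apply, Matrix.blockDiagonal_apply, neg_one_smul, map_neg]
    split_ifs <;> simp
  have hd : dK ((((kPlus w hw).twist k l).power m).shift (-1)) = D := hD.symm
  have hDh : ∀ i, D * h i + h i * D = 1 := by
    intro i
    simp only [D, h, Matrix.neg_mul, Matrix.mul_neg, neg_neg]
    rw [← Matrix.blockDiagonal_mul, ← Matrix.blockDiagonal_mul, ← Matrix.blockDiagonal_add,
      ← Matrix.blockDiagonal_one]
    congr 1
    funext _
    exact hc i
  have hs : ∀ (i : Fin 2) (J I : Finset (Fin 2)) (a b : Fin m), IsSection chartsMinus {i}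
      ((((J.card : ℤ) • ((-3, 1) : ℤ × ℤ) + (k, l)) + (0, -1)) -
        (((I.card : ℤ) • ((-3, 1) : ℤ × ℤ) + (k, l)) + (0, -1)) + (0, -1)) (h i (J, a) (I, b)) := by
    intro i J I a b
    refine IsSection.neg ?_
    rw [Matrix.blockDiagonal_apply]
    split_ifs
    swap
    · exact isSection_zero _ _ _
    simp only [c]
    rw [koszul_contraction_apply]
    split_ifs with hJ
    swap
    · exact isSection_zero _ _ _
    -- The entry is `± p_i⁻¹`: one power of the denominator and a constant numerator.
    refine ⟨1, (-1) ^ pos i I, ?_, ?_⟩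
    · have hcard : (J.card : ℤ) = I.card - 1 := by rw [hJ.2, Finset.cast_card_erase_of_mem hJ.1]
      have e : ((((J.card : ℤ) • ((-3, 1) : ℤ × ℤ) + (k, l)) + (0, -1)) -
        (((I.card : ℤ) • ((-3, 1) : ℤ × ℤ) + (k, l)) + (0, -1)) + (0, -1)) +
          1 • ∑ j ∈ {i}, wt (chartsMinus j) = 0 := by
        rw [hcard, Finset.sum_singleton]
        ext <;> simp [wt, chartsMinus] <;> ring
      rw [e]
      rcases neg_one_pow_eq_or S (pos i I) with h' | h' <;> rw [h']
      · exact isWeightedHomogeneous_one ℂ wt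
      · exact (weightedHomogeneousSubmodule ℂ wt _).neg_mem (isWeightedHomogeneous_one ℂ wt)
    · have e : denom chartsMinus {i} = p i := Finset.prod_singleton _ _
      rw [e, pow_one, mul_assoc, inv_mul_cancel₀ (hp i)]
      simp
  refine exists_isContraction_of_charts h (fun i a b => hs i a.1 b.1 a.2 b.2) fun i => ?_
  rw [hd]
  exact hDh i

end KPlusContraction

/-! ### Lifting maps along the regular sequence `p_1, p_2` -/

section Lift

theorem BiHom.of_X_mul {s : Var} {P : S} {k : ℤ × ℤ} (h : BiHom (X s * P) k) :
    BiHom P (k - wt s) := by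
  intro c hc
  rw [← coeff_X_mul c s P] at hc
  rw [← h hc, map_add, Finsupp.weight_single, one_smul, add_sub_cancel_left]

theorem BiHom.divMonomial_X {P : S} {k : ℤ × ℤ} (h : BiHom P k) (s : Var) :
    BiHom (divMonomial P (Finsupp.single s 1)) (k - wt s) := by
  intro c hc
  rw [coeff_divMonomial] at hc
  rw [← h hc, map_add, Finsupp.weight_single, one_smul, add_sub_cancel_left]

/-- A homogeneous polynomial without monomials in `x` alone lies in the ideal `(p_1, p_2)`. -/
theorem exists_eq_p_mul_add {P : S} {k : ℤ × ℤ} (hP : BiHom P k)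
    (h : ∀ c, coeff c P ≠ 0 → c (Sum.inr 0) ≠ 0 ∨ c (Sum.inr 1) ≠ 0) :
    ∃ A B, BiHom A (k - (-3, 2)) ∧ BiHom B (k - (-3, 2)) ∧ P = p 0 * A + p 1 * B := by
  let s₀ : Var →₀ ℕ := Finsupp.single (Sum.inr 0) 1
  have e := divMonomial_add_modMonomial_single P (Sum.inr 0 : Var)
  have hA := hP.divMonomial_X (Sum.inr 0)
  have hR : BiHom (modMonomial P s₀) k := by
    intro c hc
    by_cases hs : s₀ ≤ c
    · exact absurd (coeff_modMonomial_of_le _ hs) hc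
    · rw [coeff_modMonomial_of_not_le _ hs] at hc
      exact hP hc
  -- The monomials of the remainder are those of `P` not divisible by `p 0`, so by hypothesis each
  -- of them contains `p 1`.
  have hX : X (Sum.inr 1) ∣ modMonomial P s₀ := by
    rw [X_dvd_iff_modMonomial_eq_zero]
    ext c
    rw [coeff_zero]
    by_cases h1 : Finsupp.single (Sum.inr 1) 1 ≤ c
    · exact coeff_modMonomial_of_le _ h1
    rw [coeff_modMonomial_of_not_le _ h1]
    by_cases h0 : s₀ ≤ c
    · exact coeff_modMonomial_of_le _ h0
    rw [coeff_modMonomial_of_not_le _ h0]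
    by_contra hc
    simp only [s₀, Finsupp.single_le_iff, Nat.one_le_iff_ne_zero, not_not] at h0 h1
    exact (h c hc).elim (· h0) (· h1)
  obtain ⟨B, hB⟩ := hX
  rw [hB] at hR
  refine ⟨_, B, hA, BiHom.of_X_mul hR, ?_⟩
  exact e.symm.trans (congrArg _ hB)

/-- This is the regularity of the sequence `p 0, p 1`: the prime `p 1` does not divide `p 0`. -/
theorem exists_of_p_mul_eq {A B : S} (h : p 0 * A = p 1 * B) :
    ∃ C, A = p 1 * C ∧ B = p 0 * C := by
  have h1 : p 1 ∣ p 0 * A := ⟨B, h⟩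
  have h2 : p 1 ∣ A := by
    refine ((X_prime (i := (Sum.inr 1 : Var)) (R := ℂ)).dvd_or_dvd h1).resolve_left fun h => ?_
    simpa using X_dvd_X.1 h
  obtain ⟨C, rfl⟩ := h2
  refine ⟨C, rfl, ?_⟩
  rw [mul_left_comm] at h
  exact (mul_left_cancel₀ (X_ne_zero _) h).symm

variable {w : Fin 2 → MvPolynomial (Fin 6) ℂ} (hw : ∀ j, (w j).IsHomogeneous 3)

/-- A row vector `v` with `v * d = 0` modulo `(p_1, p_2)` lifts to a morphism to copies of `K_+`,
whose top exterior power resolves the restriction to `p_1 = p_2 = 0`. -/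
theorem exists_hom_kPlus (E : GMF (potential w)) (t n : ℤ) (m : ℕ) (v : Matrix (Fin m) E.ι S)
    (hv : ∀ i a, BiHom (v i a) ((t, n) - E.deg a))
    (hvd : ∀ i a c, coeff c ((v * E.d) i a) ≠ 0 → c (Sum.inr 0) ≠ 0 ∨ c (Sum.inr 1) ≠ 0) :
    ∃ g : GMF.Hom E (((kPlus w hw).twist (t + 6) (n - 2)).power m),
      ∀ i a, g.mat ((Finset.univ : Finset (Fin 2)), i) a = v i a := by
  have hmul : ∀ (M : Matrix (Fin m) E.ι S) (k : ℤ × ℤ), (∀ i a, BiHom (M i a) (k - E.deg a)) →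
      ∀ i a, BiHom ((M * E.d) i a) (k - E.deg a + (0, 1)) := by
    intro M k hM i a
    rw [Matrix.mul_apply]
    refine IsWeightedHomogeneous.sum _ _ _ fun b _ => ?_
    convert (hM i b).mul (E.d_homog b a) using 1
    abel
  choose A B hA hB hAB using fun i a => exists_eq_p_mul_add (hmul v _ hv i a) (hvd i a)
  have hA' : ∀ i a, BiHom (A i a) ((t + 3, n - 1) - E.deg a) := fun i a => by
    convert hA i a using 1
    ext <;> simp only [Prod.fst_add, Prod.fst_sub, Prod.snd_add, Prod.snd_sub] <;> ring
  have hB' : ∀ i a, BiHom (B i a) ((t + 3, n - 1) - E.deg a) := fun i a => by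
    convert hB i a using 1
    ext <;> simp only [Prod.fst_add, Prod.fst_sub, Prod.snd_add, Prod.snd_sub] <;> ring
  have e1 : v * E.d = p 0 • Matrix.of A + p 1 • Matrix.of B := by
    refine Matrix.ext fun i a => ?_
    simpa using hAB i a
  -- Multiplying `v d = p 0 A + p 1 B` by `d` and using `d² = W` yields a syzygy of `(p 0, p 1)`;
  -- its solution `C` is the component into the lowest exterior power.
  have e2 : p 0 • (Matrix.of A * E.d) + p 1 • (Matrix.of B * E.d) = potential w • v := by
    rw [← Matrix.smul_mul, ← Matrix.smul_mul, ← Matrix.add_mul, ← e1, Matrix.mul_assoc, E.d_sq]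
    simp
  have e3 : ∀ i a, p 0 * ((Matrix.of A * E.d) i a - inclX (w 0) * v i a) =
      p 1 * (inclX (w 1) * v i a - (Matrix.of B * E.d) i a) := by
    intro i a
    have := congrFun (congrFun e2 i) a
    simp only [Matrix.add_apply, Matrix.smul_apply, smul_eq_mul, potential, Fin.sum_univ_two] at this
    linear_combination this
  choose C hC1 hC2 using fun i a => exists_of_p_mul_eq (e3 i a)
  have hC : ∀ i a, BiHom (C i a) ((t + 6, n - 2) - E.deg a) := by
    intro i a
    have h1 : BiHom (p 1 * C i a) ((t + 3, n - 1) - E.deg a + (0, 1)) := by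
      rw [← hC1]
      refine (weightedHomogeneousSubmodule ℂ wt _).sub_mem (hmul _ _ hA' i a) ?_
      change BiHom _ _
      have := (inclX_homog (hw 0)).mul (hv i a)
      convert this using 1
      ext <;> simp only [Prod.fst_add, Prod.fst_sub, Prod.snd_add, Prod.snd_sub] <;> push_cast <;>
        ring
    convert BiHom.of_X_mul h1 using 1
    ext <;> simp only [Prod.fst_add, Prod.fst_sub, Prod.snd_add, Prod.snd_sub, wt, Sum.elim_inr] <;>
      ring
  have e5 : Matrix.of A * E.d = p 1 • Matrix.of C + inclX (w 0) • v :=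
    sub_eq_iff_eq_add.1 (Matrix.ext hC1)
  have e6 : Matrix.of B * E.d = inclX (w 1) • v - p 0 • Matrix.of C := by
    rw [← show inclX (w 1) • v - Matrix.of B * E.d = p 0 • Matrix.of C from Matrix.ext hC2,
      sub_sub_cancel]
  -- This last compatibility needs no further choice: it holds after multiplication by `p 1`, which
  -- can be cancelled.
  have e4 : Matrix.of C * E.d = inclX (w 1) • Matrix.of A - inclX (w 0) • Matrix.of B := by
    have h1 : p 1 • Matrix.of C = Matrix.of A * E.d - inclX (w 0) • v := by
      rw [e5, add_sub_cancel_right]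
    have h2 : p 1 • (Matrix.of C * E.d) =
        p 1 • (inclX (w 1) • Matrix.of A - inclX (w 0) • Matrix.of B) := by
      rw [← Matrix.smul_mul, h1, Matrix.sub_mul, Matrix.mul_assoc, E.d_sq, Matrix.smul_mul, e1]
      refine Matrix.ext fun i a => ?_
      simp [potential, Fin.sum_univ_two]
      ring
    refine Matrix.ext fun i a => mul_left_cancel₀ (X_ne_zero (Sum.inr 1 : Var)) ?_
    exact congrFun (congrFun h2 i) a
  -- The signs are dictated by `koszul`: adjoining `1` to `{0}` carries the sign `-1`, so `-B` at
  -- `{0}` and `A` at `{1}` reproduce `p 0 A + p 1 B` at the top.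
  let r : Finset (Fin 2) → Matrix (Fin m) E.ι S := fun J =>
    if J = Finset.univ then v else if J = {0} then -Matrix.of B else
      if J = {1} then Matrix.of A else Matrix.of C
  let G : Matrix (Finset (Fin 2) × Fin m) E.ι S := fun J a => r J.1 J.2 a
  have r0 : r ∅ = Matrix.of C := rfl
  have r1 : r {0} = -Matrix.of B := rfl
  have r2 : r {1} = Matrix.of A := rfl
  have r3 : r Finset.univ = v := rfl
  have cases : ∀ J : Finset (Fin 2), J = ∅ ∨ J = {0} ∨ J = {1} ∨ J = Finset.univ := by decide
  let d : Matrix (Finset (Fin 2)) (Finset (Fin 2)) S := koszul p fun j => inclX (w j)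
  have row : ∀ J, r J * E.d = ∑ I, d J I • r I := by
    have hu : (Finset.univ : Finset (Finset (Fin 2))) = {∅, {0}, {1}, Finset.univ} := by decide
    have hs : ∀ T : Finset (Fin 2) → Matrix (Fin m) E.ι S,
        ∑ I, T I = T ∅ + (T {0} + (T {1} + T Finset.univ)) := by
      intro T
      rw [hu, Finset.sum_insert (by decide), Finset.sum_insert (by decide),
        Finset.sum_insert (by decide), Finset.sum_singleton]
    intro J
    rw [hs, r0, r1, r2, r3]
    rcases cases J with rfl | rfl | rfl | rfl
    · rw [r0, e4]
      simp (decide := true) [d, koszul, pos, Fin.sum_univ_two]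
      abel
    · rw [r1]
      simp (decide := true) [d, koszul, pos, Fin.sum_univ_two]
      change -Matrix.of B * E.d = p 0 • Matrix.of C + -(inclX (w 1) • v)
      rw [Matrix.neg_mul, e6]
      abel
    · rw [r2]
      simp (decide := true) [d, koszul, pos, Fin.sum_univ_two]
      change _ = p 1 • Matrix.of C + inclX (w 0) • v
      rw [e5]
    · rw [r3, e1]
      simp (decide := true) [d, koszul, pos, Fin.sum_univ_two]
      abel

  have comm : G * E.d = Matrix.blockDiagonal (fun _ : Fin m => d) * G := by
    refine Matrix.ext fun ⟨J, i⟩ a => ?_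
    have h1 := congrFun (congrFun (row J) i) a
    rw [Matrix.mul_apply] at h1 ⊢
    rw [Matrix.mul_apply, Fintype.sum_prod_type]
    simp only [G]
    rw [h1, Matrix.sum_apply]
    refine Finset.sum_congr rfl fun I _ => ?_
    simp [Matrix.blockDiagonal_apply]
  refine ⟨⟨G, ?_, comm⟩, fun i a => rfl⟩
  rintro ⟨J, i⟩ a
  change BiHom (r J i a) ((J.card : ℤ) • ((-3, 1) : ℤ × ℤ) + (t + 6, n - 2) - E.deg a)
  rcases cases J with rfl | rfl | rfl | rfl
  · rw [r0]
    simpa using hC i a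
  · rw [r1]
    refine (weightedHomogeneousSubmodule ℂ wt _).neg_mem ?_
    change BiHom (B i a) _
    convert hB' i a using 1
    ext <;> simp <;> ring
  · rw [r2]
    change BiHom (A i a) _
    convert hA' i a using 1
    ext <;> simp <;> ring
  · rw [r3]
    convert hv i a using 1
    ext <;> simp

end Lift

/-! ### One replacement step -/

section Step

theorem GMF.summands_eq_sum {W : S} (E : GMF W) : E.summands = ∑ a, {E.deg a} := by
  rw [Finset.sum, GMF.summands, ← Multiset.sum_map_singleton (Multiset.map _ _), Multiset.map_map]
  rfl

variable {w : Fin 2 → MvPolynomial (Fin 6) ℂ} (hw : ∀ j, (w j).IsHomogeneous 3)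

/-- `E'` is obtained from `E` by splitting off a map to `K_+(t + 6)[n - 2]^m`, which replaces the
summand `O(t)[n]^m` by `O(t + 6)[n - 3]^m` and `O(t + 3)[n - 2]^{2m}`. -/
def IsStep (t n : ℤ) (m : ℕ) (E E' : GMF (potential w)) : Prop :=
  (∃ g : GMF.Hom E (((kPlus w hw).twist (t + 6) (n - 2)).power m),
    Nonempty ((DMF.of E' : DMF chartsPlus (potential w)) ≅ DMF.of ((GMF.cone g).shift (-1))) ∧
    Nonempty ((DMF.of E' : DMF chartsMinus (potential w)) ≅ DMF.of ((GMF.cone g).shift (-1)))) ∧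
  Multiset.replicate m (t, n) ≤ E.summands ∧
  E'.summands = E.summands - Multiset.replicate m (t, n) +
    Multiset.replicate m (t + 6, n - 3) + Multiset.replicate (2 * m) (t + 3, n - 2)

variable {hw} in
-- Over `X_-` the target of `g` is contractible, so passing to the shifted cone does not change the
-- isomorphism class.
theorem IsStep.nonempty_iso {t n : ℤ} {m : ℕ} {E E' : GMF (potential w)}
    (h : IsStep hw t n m E E') :
    Nonempty ((DMF.of E' : DMF chartsMinus (potential w)) ≅ DMF.of E) := by
  obtain ⟨⟨g, -, ⟨e⟩⟩, -⟩ := h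
  obtain ⟨H, hH⟩ := exists_isContraction_kPlus w hw (t + 6) (n - 2) m
  obtain ⟨e'⟩ := nonempty_iso_shift_cone g hH
  exact ⟨e.trans e'.symm⟩

theorem weight_fst_nonneg_of_no_p {c : Var →₀ ℕ} (h0 : c (Sum.inr 0) = 0) (h1 : c (Sum.inr 1) = 0) :
    0 ≤ (Finsupp.weight wt c).1 ∧ (Finsupp.weight wt c).2 = 0 := by
  rw [Finsupp.weight_apply, Finsupp.sum_fintype _ _ (by simp), Fintype.sum_sum_type,
    Fin.sum_univ_two (f := fun j => c (Sum.inr j) • wt (Sum.inr j)), h0, h1]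
  simp only [wt, Sum.elim_inl, zero_smul, add_zero, Prod.fst_sum, Prod.snd_sum]
  simp only [Prod.smul_fst, Prod.smul_snd, smul_zero, Finset.sum_const_zero, and_true]
  exact Finset.sum_nonneg fun _ _ => by simp

/-- The two hypotheses leave no room for `p`-free entries of `d` into the summands `O(t)[n]`. The
projection onto these summands therefore lifts to `K_+`, and elimination in the shifted cone removes
them. -/
theorem exists_isStep (E : GMF (potential w)) (t n : ℤ) (hmin : ∀ k ∈ E.summands, t ≤ k.1)
    (hno : (t, n + 1) ∉ E.summands) :
    ∃ E', IsStep hw t n (E.summands.count (t, n)) E E' := by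
  let B : Type := {a : E.ι // E.deg a = (t, n)}
  have hmem : ∀ a, E.deg a ∈ E.summands := fun a =>
    Multiset.mem_map_of_mem _ (Finset.mem_univ a)
  have hsplit : E.summands = Multiset.replicate (Fintype.card B) (t, n) +
      ∑ a : {a : E.ι // ¬E.deg a = (t, n)}, {E.deg a} := by
    rw [E.summands_eq_sum, ← Fintype.sum_subtype_add_sum_subtype (fun a => E.deg a = (t, n))]
    congr 1
    rw [Finset.sum_congr rfl (g := fun _ => {(t, n)}) (fun a _ => by rw [a.2]), Finset.sum_const,
      Multiset.nsmul_singleton]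
    rfl
  have hcard : Fintype.card B = E.summands.count (t, n) := by
    rw [hsplit, Multiset.count_add, Multiset.count_replicate_self, Multiset.count_sum',
      Finset.sum_eq_zero, add_zero]
    intro a _
    exact Multiset.count_eq_zero.2 fun h => a.2 (Multiset.mem_singleton.1 h).symm
  obtain ⟨m, hm⟩ : ∃ m, m = E.summands.count (t, n) := ⟨_, rfl⟩
  rw [← hm] at hcard ⊢
  rw [hcard] at hsplit
  let σ : Fin m ≃ B := (Fintype.equivFinOfCardEq hcard).symm
  let v : Matrix (Fin m) E.ι S := fun i a => if a = (σ i).1 then 1 else 0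
  obtain ⟨g, hg⟩ := exists_hom_kPlus hw E t n m v (fun i a => by
      simp only [v]
      split_ifs with h
      · rw [h, (σ i).2, sub_self]
        exact isWeightedHomogeneous_one ℂ wt
      · exact isWeightedHomogeneous_zero _ _ _) (fun i a c hc => by
      have e : (v * E.d) i a = E.d (σ i).1 a := by
        rw [Matrix.mul_apply]
        simp [v]
      rw [e] at hc
      have h1 := E.d_homog _ _ hc
      -- A `p`-free monomial in the entry from a summand `O(k)[l]` has weights `t - k ≥ 0` and `n -
      -- l + 1 = 0`. With `t ≤ k` this makes the source `O(t)[n + 1]`, which is excluded.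
      by_contra! h
      have h2 := weight_fst_nonneg_of_no_p h.1 h.2
      rw [h1, (σ i).2] at h2
      have h3 := hmin _ (hmem a)
      refine hno ?_
      have : (t, n + 1) = E.deg a := by
        ext
        · have := h2.1
          simp only [Prod.fst_add, Prod.fst_sub] at this ⊢
          linarith
        · have := h2.2
          simp only [Prod.snd_add, Prod.snd_sub] at this ⊢
          linarith
      rw [this]
      exact hmem a)
  -- The survivors are the other summands of `E` and the three lower basis elements of each copy of
  -- `K_+`. The `m` summands `O(t)[n]` of `E` cancel against the top exterior powers.
  let α : Type := {a : E.ι // ¬E.deg a = (t, n)} ⊕ {J : Finset (Fin 2) // ¬J = Finset.univ} × Fin m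
  let ia : α → E.ι ⊕ Finset (Fin 2) × Fin m := Sum.map Subtype.val (Prod.map Subtype.val id)
  let b : Fin m → E.ι ⊕ Finset (Fin 2) × Fin m := fun i => Sum.inl (σ i).1
  let b' : Fin m → E.ι ⊕ Finset (Fin 2) × Fin m := fun i => Sum.inr (Finset.univ, i)
  have hbij : Function.Bijective (Sum.elim ia (Sum.elim b b')) := by
    constructor
    · rintro ((a | ⟨J, i⟩) | i | i) ((a' | ⟨J', i'⟩) | i' | i') h <;>
        simp only [ia, b, b', Sum.elim_inl, Sum.elim_inr, Sum.map_inl, Sum.map_inr, Sum.inl.injEq,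
          Sum.inr.injEq, Prod.map_apply, Prod.mk.injEq, reduceCtorEq, id] at h
      · rw [Subtype.ext h]
      · exact absurd (h ▸ (σ i').2) a.2
      · rw [Subtype.ext h.1, h.2]
      · exact absurd h.1 J.2
      · exact absurd (h.symm ▸ (σ i).2) a'.2
      · rw [σ.injective (Subtype.ext h)]
      · exact absurd h.1.symm J'.2
      · rw [h.2]
    · rintro (a | ⟨J, i⟩)
      · by_cases h : E.deg a = (t, n)
        · exact ⟨.inr (.inl (σ.symm ⟨a, h⟩)), by simp [b]⟩
        · exact ⟨.inl (.inl ⟨a, h⟩), rfl⟩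
      · by_cases h : J = Finset.univ
        · exact ⟨.inr (.inr i), by simp [b', h]⟩
        · exact ⟨.inl (.inr (⟨J, h⟩, i)), rfl⟩
  obtain ⟨E', hE', iso⟩ := exists_gaussian_elimination ((GMF.cone g).shift (-1)) ia b b' hbij
    -- The block of the cone is the top row of `g`, a permuted identity, and the shift by `-1`
    -- negates it.
    (fun j k => by
      change (-1 : ℤ) • g.mat (Finset.univ, j) (σ k).1 = _
      rw [hg, neg_one_smul]
      simp only [v, Subtype.val_inj, EmbeddingLike.apply_eq_iff_eq, eq_comm (a := k)]
      split_ifs <;> simp)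
    (fun j => by
      change E.deg (σ j).1 + (0, 1) + (0, -1) -
        ((((Finset.univ : Finset (Fin 2)).card : ℤ) • ((-3, 1) : ℤ × ℤ) + (t + 6, n - 2)) + (0, -1)) +
          (0, -1) = 0
      rw [(σ j).2]
      ext <;> simp)
  refine ⟨E', ⟨g, iso _ _, iso _ _⟩, ?_, ?_⟩
  · rw [hsplit]
    exact le_self_add
  · have hs : E'.summands = ∑ a : α, {((GMF.cone g).shift (-1)).deg (ia a)} := by
      rw [hE', Finset.sum, ← Multiset.sum_map_singleton (Multiset.map _ _), Multiset.map_map]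
      rfl
    rw [hs, Fintype.sum_sum_type, Fintype.sum_prod_type, hsplit, add_tsub_cancel_left, add_assoc]
    have hu : (Finset.univ.filter fun J : Finset (Fin 2) => ¬J = Finset.univ) = {∅, {0}, {1}} := by
      decide
    congr 1
    · refine Finset.sum_congr rfl fun a _ => ?_
      change {E.deg a + (0, 1) + (0, -1)} = _
      rw [add_assoc]
      exact congrArg _ (add_zero _)
    · let D : Finset (Fin 2) → ℤ × ℤ := fun J =>
        (J.card : ℤ) • ((-3, 1) : ℤ × ℤ) + (t + 6, n - 2) + (0, -1)
      change ∑ J : {J : Finset (Fin 2) // ¬J = Finset.univ}, ∑ i : Fin m, {D J.1} = _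
      have h0 : D ∅ = (t + 6, n - 3) := by ext <;> simp [D]; ring
      have h1 : ∀ j, D {j} = (t + 3, n - 2) := fun j => by ext <;> simp [D] <;> ring
      simp only [Finset.sum_const, Finset.card_univ, Fintype.card_fin, Multiset.nsmul_singleton]
      rw [← Finset.sum_subtype (Finset.univ.filter fun J : Finset (Fin 2) => ¬J = Finset.univ)
        (by simp) (fun J => Multiset.replicate m (D J)), hu, Finset.sum_insert (by decide),
        Finset.sum_pair (by decide), h0, h1, h1, two_mul, Multiset.replicate_add]

end Step

/-! ### Iterating the step through the windows -/

section Chain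
variable {w : Fin 2 → MvPolynomial (Fin 6) ℂ} (hw : ∀ j, (w j).IsHomogeneous 3)

/-- `n` is the largest `l` for which `O(t)[l]` is a summand of `E`. -/
def IsTop {W : S} (E : GMF W) (t n : ℤ) : Prop :=
  (t, n) ∈ E.summands ∧ ∀ l, (t, l) ∈ E.summands → l ≤ n

open Classical in
/-- The replacement of all `O(t)[n]` with `n` maximal, if there are any. -/
noncomputable def next (t : ℤ) (E : GMF (potential w)) : GMF (potential w) :=
  if h : ∃ E', ∃ n, IsTop E t n ∧ IsStep hw t n (E.summands.count (t, n)) E E' then h.choose else E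

theorem isStep_next {t n : ℤ} {E : GMF (potential w)} (hmin : ∀ k ∈ E.summands, t ≤ k.1)
    (hn : IsTop E t n) : IsStep hw t n (E.summands.count (t, n)) E (next hw t E) := by
  have h : ∃ E', ∃ n, IsTop E t n ∧ IsStep hw t n (E.summands.count (t, n)) E E' := by
    obtain ⟨E', hE'⟩ := exists_isStep hw E t n hmin fun h => by
      have := hn.2 _ h
      omega
    exact ⟨E', n, hn, hE'⟩
  obtain ⟨n', hn', hs⟩ := h.choose_spec
  -- The level hidden in the choice of `next` is forced, since a top level is unique.
  have e : n' = n := le_antisymm (hn.2 _ hn'.1) (hn'.2 _ hn.1)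
  subst e
  rw [next, dif_pos h]
  exact hs

/-- New summands have weight `t + 3` or `t + 6`, so each step only deletes the current top level in
weight `t`. The next listed level then becomes the top one, and after `s` steps weight `t` is
exhausted. -/
theorem isStep_iterate_next {t : ℤ} {E : GMF (potential w)}
    (hE : ∀ k ∈ E.summands, t ≤ k.1 ∧ k.1 ≤ t + 6) {s : ℕ} {n : Fin s → ℤ} {m : Fin s → ℕ}
    (hn : StrictAnti n) (hm : ∀ i, 0 < m i)
    (hf : E.summands.filter (fun k => k.1 = t) = ∑ i, Multiset.replicate (m i) (t, n i)) :
    (∀ i : Fin s, IsStep hw t (n i) (m i) ((next hw t)^[i] E) ((next hw t)^[i + 1] E)) ∧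
      ∀ k ∈ ((next hw t)^[s] E).summands, t + 1 ≤ k.1 ∧ k.1 ≤ t + 6 := by
  -- The summands of weight `t` that remain after `j` steps.
  let M : ℕ → Multiset (ℤ × ℤ) := fun j =>
    ∑ i ∈ Finset.univ.filter (fun i : Fin s => j ≤ i), Multiset.replicate (m i) (t, n i)
  have step : ∀ (E : GMF (potential w)) (i : Fin s), (∀ k ∈ E.summands, t ≤ k.1 ∧ k.1 ≤ t + 6) →
      E.summands.filter (fun k => k.1 = t) = M i →
      IsStep hw t (n i) (m i) E (next hw t E) ∧
      (∀ k ∈ (next hw t E).summands, t ≤ k.1 ∧ k.1 ≤ t + 6) ∧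
      (next hw t E).summands.filter (fun k => k.1 = t) = M (i + 1) := by
    intro E i hE hf
    have hM : M i = Multiset.replicate (m i) (t, n i) + M (i + 1) := by
      have : Finset.univ.filter (fun j : Fin s => (i : ℕ) ≤ j) =
          insert i (Finset.univ.filter (fun j : Fin s => (i : ℕ) + 1 ≤ j)) := by
        ext j
        simp only [Finset.mem_filter, Finset.mem_univ, true_and, Finset.mem_insert, Fin.ext_iff]
        omega
      simp only [M]
      rw [this, Finset.sum_insert (by simp)]
    have hlt : ∀ l, (t, l) ∈ M (i + 1) → l < n i := by
      intro l hl
      simp only [M, Multiset.mem_sum] at hl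
      obtain ⟨j, hj, hl⟩ := hl
      have := Multiset.eq_of_mem_replicate hl
      rw [show l = n j from (Prod.ext_iff.1 this).2]
      exact hn (Fin.lt_def.2 (by simpa using hj))
    have hmem : ∀ l, (t, l) ∈ E.summands ↔ (t, l) ∈ M i := fun l => by
      rw [← hf, Multiset.mem_filter]
      simp
    have htop : IsTop E t (n i) := by
      constructor
      · rw [hmem, hM, Multiset.mem_add, Multiset.mem_replicate]
        exact .inl ⟨(hm i).ne', rfl⟩
      · intro l hl
        rw [hmem, hM, Multiset.mem_add, Multiset.mem_replicate] at hl
        rcases hl with hl | hl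
        · exact (Prod.ext_iff.1 hl.2).2.le
        · exact (hlt l hl).le
    have hcount : E.summands.count (t, n i) = m i := by
      rw [← Multiset.count_filter_of_pos (p := fun k => k.1 = t) rfl, hf, hM, Multiset.count_add,
        Multiset.count_replicate_self, Multiset.count_eq_zero_of_notMem, add_zero]
      exact fun h => lt_irrefl _ (hlt _ h)
    have hs := isStep_next hw (fun k hk => (hE k hk).1) htop
    rw [hcount] at hs
    refine ⟨hs, fun k hk => ?_, ?_⟩
    · rw [hs.2.2, Multiset.mem_add, Multiset.mem_add, Multiset.mem_replicate,
        Multiset.mem_replicate] at hk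
      rcases hk with (hk | ⟨-, rfl⟩) | ⟨-, rfl⟩
      · exact hE k (Multiset.mem_of_le tsub_le_self hk)
      · simp
      · simp only; omega
    · have h1 : (Multiset.replicate (m i) (t + 6, n i - 3)).filter (fun k => k.1 = t) = 0 :=
        Multiset.filter_eq_nil.2 fun k hk => by
          rw [Multiset.eq_of_mem_replicate hk]; simp
      have h2 : (Multiset.replicate (2 * m i) (t + 3, n i - 2)).filter (fun k => k.1 = t) = 0 :=
        Multiset.filter_eq_nil.2 fun k hk => by
          rw [Multiset.eq_of_mem_replicate hk]; simp
      have h3 : (Multiset.replicate (m i) (t, n i)).filter (fun k => k.1 = t) =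
          Multiset.replicate (m i) (t, n i) :=
        Multiset.filter_eq_self.2 fun k hk => by rw [Multiset.eq_of_mem_replicate hk]
      rw [hs.2.2, Multiset.filter_add, Multiset.filter_add, h1, h2, Multiset.filter_sub, h3, hf, hM,
        add_tsub_cancel_left, add_zero, add_zero]
  have inv : ∀ j ≤ s, (∀ k ∈ ((next hw t)^[j] E).summands, t ≤ k.1 ∧ k.1 ≤ t + 6) ∧
      ((next hw t)^[j] E).summands.filter (fun k => k.1 = t) = M j := by
    intro j
    induction j with
    | zero => exact fun _ => ⟨hE, by simp [hf, M]⟩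
    | succ j ih =>
      intro hj
      have h := ih (by omega)
      rw [Function.iterate_succ_apply']
      exact (step _ ⟨j, hj⟩ h.1 h.2).2
  refine ⟨fun i => ?_, fun k hk => ?_⟩
  · have h := inv i i.2.le
    rw [Function.iterate_succ_apply']
    exact (step _ i h.1 h.2).1
  · have h := inv s le_rfl
    have hM : M s = 0 := Finset.sum_eq_zero fun i hi => by
      simp only [Finset.mem_filter] at hi
      omega
    have h1 := h.1 k hk
    have h2 : k.1 ≠ t := fun e => by
      have := Multiset.mem_filter (p := fun k : ℤ × ℤ => k.1 = t).2 ⟨hk, e⟩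
      rw [h.2, hM] at this
      simp at this
    omega

/-- The number of different `l` such that `O(t)[l]` is a summand of `E`. -/
def numLevels {W : S} (E : GMF W) (t : ℤ) : ℕ :=
  (E.summands.filter (fun k => k.1 = t)).toFinset.card

/-- The sequence has to be fixed before any listing of levels is given; this makes the number of
steps agree with the length of every admissible listing. -/
theorem numLevels_eq {W : S} {E : GMF W} {t : ℤ} {s : ℕ} {n : Fin s → ℤ} {m : Fin s → ℕ}
    (hn : StrictAnti n) (hm : ∀ i, 0 < m i)
    (hf : E.summands.filter (fun k => k.1 = t) = ∑ i, Multiset.replicate (m i) (t, n i)) :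
    numLevels E t = s := by
  have : (E.summands.filter (fun k => k.1 = t)).toFinset =
      Finset.univ.map ⟨fun i => (t, n i), fun i j h => hn.injective (Prod.ext_iff.1 h).2⟩ := by
    ext k
    simp only [hf, Multiset.mem_toFinset, Multiset.mem_sum, Multiset.mem_replicate,
      Finset.mem_map, Finset.mem_univ, true_and]
    exact ⟨fun ⟨i, h⟩ => ⟨i, h.2.symm⟩, fun ⟨i, h⟩ => ⟨i, (hm i).ne', h.symm⟩⟩
  rw [numLevels, this]
  simp

theorem exists_levels {W : S} (E : GMF W) (t : ℤ) : ∃ (s : ℕ) (n : Fin s → ℤ) (m : Fin s → ℕ),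
    StrictAnti n ∧ (∀ i, 0 < m i) ∧
    E.summands.filter (fun k => k.1 = t) = ∑ i, Multiset.replicate (m i) (t, n i) := by
  let M := E.summands.filter (fun k => k.1 = t)
  let A : Finset ℤ := M.toFinset.image Prod.snd
  have hA : ∀ l, l ∈ A ↔ (t, l) ∈ M := by
    intro l
    simp only [A, Finset.mem_image, Multiset.mem_toFinset]
    refine ⟨?_, fun h => ⟨_, h, rfl⟩⟩
    rintro ⟨⟨a, b⟩, h, rfl⟩
    have : a = t := (Multiset.mem_filter.1 h).2
    rwa [this] at h
  -- The enumeration of `A` is increasing, so the index is reversed to list the levels in decreasing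
  -- order.
  refine ⟨A.card, fun i => A.orderEmbOfFin rfl i.rev,
    fun i => M.count (t, A.orderEmbOfFin rfl i.rev), ?_, ?_, ?_⟩
  · exact fun i j h => (A.orderEmbOfFin rfl).strictMono (Fin.rev_lt_rev.2 h)
  · intro i
    rw [Multiset.count_pos, ← hA]
    exact Finset.orderEmbOfFin_mem _ _ _
  · change M = _
    have h0 := Equiv.sum_comp Fin.revPerm (fun i => Multiset.replicate
      (M.count (t, A.orderEmbOfFin rfl i)) (t, A.orderEmbOfFin rfl i))
    simp only [Fin.revPerm_apply] at h0
    rw [h0]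
    have h1 : ∑ i, Multiset.replicate (M.count (t, A.orderEmbOfFin rfl i))
        (t, A.orderEmbOfFin rfl i) = ∑ l ∈ A, Multiset.replicate (M.count (t, l)) (t, l) := by
      rw [← Finset.sum_coe_sort A]
      exact (A.orderIsoOfFin rfl).toEquiv.sum_comp
        (fun l => Multiset.replicate (M.count (t, l.1)) (t, l.1))
    rw [h1]
    ext ⟨a, b⟩
    rw [Multiset.count_sum']
    by_cases ha : a = t
    · subst ha
      rw [Finset.sum_congr rfl (g := fun l => if l = b then M.count (a, l) else 0) fun l _ => by
        rw [Multiset.count_replicate]; simp]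
      rw [Finset.sum_ite_eq']
      split_ifs with hb
      · rfl
      · rw [hA] at hb
        exact Multiset.count_eq_zero_of_notMem hb
    · rw [Finset.sum_eq_zero]
      · exact Multiset.count_eq_zero_of_notMem fun h => ha (Multiset.mem_filter.1 h).2
      · intro l _
        rw [Multiset.count_replicate, if_neg fun h => ha (Prod.ext_iff.1 h).1.symm]

/-- The factorizations obtained from `E` by removing in turn the summands `O(0)[l]`, the summands
`O(1)[l]` and so on. -/
noncomputable def windowShift (E : GMF (potential w)) : ℕ → GMF (potential w)
  | 0 => E
  | t + 1 => (next hw t)^[numLevels (windowShift E t) t] (windowShift E t)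

theorem windowShift_succ (E : GMF (potential w)) (t : ℕ) : windowShift hw E (t + 1) =
    (next hw t)^[numLevels (windowShift hw E t) t] (windowShift hw E t) := rfl

/-- The bound `t + 6` is one weaker than necessary for `t ≥ 1`, but it also covers the initial term
`K_-` of width six and suffices for the induction. -/
theorem windowShift_window {E : GMF (potential w)} (hE : ∀ k ∈ E.summands, 0 ≤ k.1 ∧ k.1 ≤ 6)
    (t : ℕ) : ∀ k ∈ (windowShift hw E t).summands, (t : ℤ) ≤ k.1 ∧ k.1 ≤ t + 6 := by
  induction t with
  | zero => exact fun k hk => by simpa using hE k hk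
  | succ t ih =>
    intro k hk
    obtain ⟨s, n, m, hn, hm, hf⟩ := exists_levels (windowShift hw E t) t
    rw [windowShift_succ, numLevels_eq hn hm hf] at hk
    have := (isStep_iterate_next hw ih hn hm hf).2 k hk
    push_cast
    omega

theorem windowShift_succ_window {E : GMF (potential w)}
    (hE : ∀ k ∈ E.summands, 0 ≤ k.1 ∧ k.1 ≤ 6) (t : ℕ) :
    ∀ k ∈ (windowShift hw E (t + 1)).summands, (t : ℤ) + 1 ≤ k.1 ∧ k.1 ≤ t + 6 := by
  intro k hk
  obtain ⟨s, n, m, hn, hm, hf⟩ := exists_levels (windowShift hw E t) t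
  rw [windowShift_succ, numLevels_eq hn hm hf] at hk
  exact (isStep_iterate_next hw (windowShift_window hw hE t) hn hm hf).2 k hk

theorem windowShift_iso {E : GMF (potential w)} (hE : ∀ k ∈ E.summands, 0 ≤ k.1 ∧ k.1 ≤ 6)
    (t : ℕ) : Nonempty ((DMF.of (windowShift hw E t) : DMF chartsMinus (potential w)) ≅
      DMF.of E) := by
  induction t with
  | zero => exact ⟨CategoryTheory.Iso.refl _⟩
  | succ t ih =>
    obtain ⟨s, n, m, hn, hm, hf⟩ := exists_levels (windowShift hw E t) t
    have h := (isStep_iterate_next hw (windowShift_window hw hE t) hn hm hf).1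
    rw [windowShift_succ, numLevels_eq hn hm hf]
    have aux : ∀ j ≤ s, Nonempty ((DMF.of ((next hw t)^[j] (windowShift hw E t)) :
        DMF chartsMinus (potential w)) ≅ DMF.of E) := by
      intro j
      induction j with
      | zero => exact fun _ => ih
      | succ j ihj =>
        intro hj
        obtain ⟨e⟩ := ihj (by omega)
        obtain ⟨e'⟩ := (h ⟨j, hj⟩).nonempty_iso
        exact ⟨e'.trans e⟩
    exact aux s le_rfl

theorem kMinus_window (f : Fin 2 → Fin 6 → MvPolynomial (Fin 6) ℂ)
    (hf : ∀ j i, (f j i).IsHomogeneous 2) (hwf : ∀ j, w j = ∑ i, X i * f j i) :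
    ∀ k ∈ (kMinus w f hf hwf).summands, 0 ≤ k.1 ∧ k.1 ≤ 6 := by
  intro k hk
  obtain ⟨I, -, rfl⟩ := Multiset.mem_map.1 hk
  change 0 ≤ (((I : Finset (Fin 6)).card : ℤ) • ((1, -1) : ℤ × ℤ)).1 ∧
    (((I : Finset (Fin 6)).card : ℤ) • ((1, -1) : ℤ × ℤ)).1 ≤ 6
  have := Finset.card_le_univ (α := Fin 6) I
  simp only [Fintype.card_fin] at this
  simp only [Prod.smul_fst, smul_eq_mul, mul_one]
  omega

end Chain

end LGCY

/-! ### The theorem -/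

theorem mainTheorem5
    (W : Fin 2 → MvPolynomial (Fin 6) ℂ) (hW : ∀ j, (W j).IsHomogeneous 3)
    (f : Fin 2 → Fin 6 → MvPolynomial (Fin 6) ℂ) (hf : ∀ j i, (f j i).IsHomogeneous 2)
    (hWf : ∀ j, W j = ∑ i, MvPolynomial.X i * f j i) :
    ∃ Kt : ℕ → LGCY.GMF (LGCY.potential W),
      (∀ t : ℕ, 1 ≤ t → Nonempty
        ((LGCY.DMF.of (Kt t) : LGCY.DMF LGCY.chartsMinus (LGCY.potential W)) ≅
          LGCY.DMF.of (LGCY.kMinus W f hf hWf))) ∧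
      (∀ t : ℕ, 1 ≤ t → ∀ k ∈ (Kt t).summands, (t : ℤ) ≤ k.1 ∧ k.1 ≤ (t : ℤ) + 5) ∧
      (∀ t : ℕ, 1 ≤ t → ∀ (s : ℕ) (n : Fin s → ℤ) (m : Fin s → ℕ),
        StrictAnti n → (∀ i, 0 < m i) →
        (Kt t).summands.filter (fun k => k.1 = (t : ℤ)) =
          ∑ i, Multiset.replicate (m i) ((t : ℤ), n i) →
        ∃ L : Fin (s + 1) → LGCY.GMF (LGCY.potential W),
          L 0 = Kt t ∧ L (Fin.last s) = Kt (t + 1) ∧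
          ∀ i : Fin s,
            (∃ g : LGCY.GMF.Hom (L i.castSucc)
                (((LGCY.kPlus W hW).twist ((t : ℤ) + 6) (n i - 2)).power (m i)),
              Nonempty ((LGCY.DMF.of (L i.succ) :
                  LGCY.DMF LGCY.chartsPlus (LGCY.potential W)) ≅
                LGCY.DMF.of ((LGCY.GMF.cone g).shift (-1))) ∧
              Nonempty ((LGCY.DMF.of (L i.succ) :
                  LGCY.DMF LGCY.chartsMinus (LGCY.potential W)) ≅
                LGCY.DMF.of ((LGCY.GMF.cone g).shift (-1)))) ∧
            Multiset.replicate (m i) ((t : ℤ), n i) ≤ (L i.castSucc).summands ∧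
            (L i.succ).summands =
              (L i.castSucc).summands - Multiset.replicate (m i) ((t : ℤ), n i) +
                Multiset.replicate (m i) ((t : ℤ) + 6, n i - 3) +
                Multiset.replicate (2 * m i) ((t : ℤ) + 3, n i - 2)) := by
  have hE := LGCY.kMinus_window f hf hWf
  refine ⟨LGCY.windowShift hW (LGCY.kMinus W f hf hWf), fun t _ => LGCY.windowShift_iso hW hE t,
    fun t ht k hk => ?_, fun t _ s n m hn hm hfil =>
    ⟨fun i => (LGCY.next hW t)^[i] (LGCY.windowShift hW (LGCY.kMinus W f hf hWf) t), rfl, ?_,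
      fun i => ?_⟩⟩
  -- Here `t ≥ 1` is essential: only a term that comes from a previous stage has the narrower
  -- window.
  · obtain ⟨t, rfl⟩ := Nat.exists_eq_add_of_le' ht
    have := LGCY.windowShift_succ_window hW hE t k hk
    push_cast
    omega
  · rw [LGCY.windowShift_succ, LGCY.numLevels_eq hn hm hfil]
    rfl
  · exact (LGCY.isStep_iterate_next hW (LGCY.windowShift_window hW hE t) hn hm hfil).1 i
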